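/- Let $s\ge 1$ and let $m_1,\dots,m_s$ and $n_1,\dots,n_s$ be integers with $m_j>1$ and $n_j\ge 2$ for $1\le j\le s-1$, $m_s=1$ and $n_s\ge 0$. Put $n=n_1+\cdots+n_s$, write $z=(z_1,\dots,z_s)\in\mathbb C^{n_1}\times\cdots\times\mathbb C^{n_s}=\mathbb C^n$, denote by $z^\alpha$, $1\le\alpha\le n$, the coordinates of $z$, by $I_j\subset\{1,\dots,n\}$ the set of the indices of the variables in $z_j$, and let $$p(z,\bar z)=|z_1|^{2m_1}+\cdots+|z_{s-1}|^{2m_{s-1}}+|z_s|^2 ,$$ $$M=\{(z,z^{n+1})\in\mathbb C^{n+1}:\ \operatorname{Im} z^{n+1}=p(z,\bar z),\ z_j\ne 0 \text{ for } 1\le j\le s-1\}.$$ Use on $M$ the coordinates $(z,t)\in\mathbb C^n\times\mathbb R$, i.e. identify $(z,t)$ with the point $(z,t+ip(z,\bar z))$. Let $\mathcal T M=T^{1,0}M$ be the holomorphic tangent bundle of $M\subset\mathbb C^{n+1}$, with frame $Z_\alpha=\partial_\alpha+ip_\alpha\partial_t$, where $p_\alpha=\partial p/\partial z^\alpha$.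 Let $\vartheta=dt-i\sum_\alpha(p_\alpha dz^\alpha-p_{\bar\alpha}d\bar z^\alpha)$ be the contact form, $L=-i\,d\vartheta$ the Levi form, $h_{\alpha\bar\beta}=L(Z_\alpha,\bar Z_\beta)$, and $h^{\alpha\bar\beta}$ the matrix with $\sum_\beta h^{\alpha\bar\beta}h_{\gamma\bar\beta}=\delta^\alpha_\gamma$. Let $\nabla$ be the Tanaka–Webster connection of $(M,\vartheta)$, let $R(X,Y)V=\nabla_X\nabla_YV-\nabla_Y\nabla_XV-\nabla_{[X,Y]}V$ and $R_{\alpha\bar\beta\lambda\bar\mu}=L(R(Z_\lambda,\bar Z_\mu)Z_\alpha,\bar Z_\beta)$. Let $\mathrm{Ric}$ be the pseudohermitian Ricci tensor, with components $R_{\alpha\bar\mu}=\mathrm{Ric}(Z_\alpha,\bar Z_\mu)=\sum_{\lambda,\beta}h^{\lambda\bar\beta}R_{\alpha\bar\beta\lambda\bar\mu}$, and let $R=\sum_{\alpha,\mu}h^{\alpha\bar\mu}R_{\alpha\bar\mu}$ be the scalar curvature. Let $E_j=\frac1{m_j}\sum_{\alpha\in I_j}z^\alpha Z_\alpha$, let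 $\mathcal E$ be the span of $E_1,\dots,E_s$, let $$Q(Z)=Z-\sum_{j}\frac{L(Z,\bar E_j)}{L(E_j,\bar E_j)}E_j ,$$ where the terms with $E_j=0$ are omitted, and let $\mathcal W_s$ be the span of the vectors $Q(Z_\alpha)$, $\alpha\in I_s$. (Thus $\mathcal E\oplus\mathcal W_s$ is the span of $E_1,\dots,E_{s-1}$ and of the $Z_\alpha$ with $\alpha\in I_s$.) Let $N,N'\subset M$ be open sets and let $f:N\to N'$ be a CR diffeomorphism with CR factor $\lambda$: a smooth diffeomorphism whose tangent mapping $f_*$ maps $T^{1,0}N$ into $T^{1,0}N'$ and for which $f^*\vartheta=\lambda\vartheta$ with $\lambda>0$ on $N$. Assume that $f_*\big((\mathcal E\oplus\mathcal W_s)_P\big)=(\mathcal E\oplus\mathcal W_s)_{f(P)}$ for all $P\in N$. Then $f$ preserves the Ricci curvature of $\vartheta$, i.e. $$\mathrm{Ric}(f_*Z,f_*\bar W)=\mathrm{Ric}(Z,\bar W)\qquad\text{for all } P\in N,\ Z,W\in T^{1,0}_PN .$$ Moreover $R=\lambda\cdot(R\circ f)$ on $N$. -/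

import Mathlib

open scoped ContDiff ComplexConjugate

namespace RigidCR

/-! ### Complex vector fields on `ℂⁿ × ℝ`

A rigid hypersurface `Im z^{n+1} = p(z)` of `ℂⁿ⁺¹` is identified with `ℂⁿ × ℝ` through the
global coordinates `(z, t) ↦ (z, t + i p(z))`. The index type `ι` numbers the variables
`z^α` of `ℂⁿ`. -/

/-- Points `(z, t)` of the hypersurface, in the coordinates `t = Re z^{n+1}`. -/
abbrev Pt (ι : Type) : Type := (ι → ℂ) × ℝ

/-- Complexified tangent vectors: `(a, b, c)` stands for
`∑ a^α ∂/∂z^α + ∑ b^α ∂/∂z̄^α + c ∂/∂t`. -/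
abbrev CTan (ι : Type) : Type := (ι → ℂ) × (ι → ℂ) × ℂ

section General

variable {ι : Type} [Fintype ι] [DecidableEq ι]

/-- `∂u/∂z^α = (∂u/∂x^α - i ∂u/∂y^α) / 2`. -/
noncomputable def dz (u : Pt ι → ℂ) (x : Pt ι) (α : ι) : ℂ :=
  (fderiv ℝ u x (Pi.single α 1, 0) - Complex.I * fderiv ℝ u x (Pi.single α Complex.I, 0)) / 2

/-- `∂u/∂z̄^α = (∂u/∂x^α + i ∂u/∂y^α) / 2`. -/
noncomputable def dzbar (u : Pt ι → ℂ) (x : Pt ι) (α : ι) : ℂ :=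
  (fderiv ℝ u x (Pi.single α 1, 0) + Complex.I * fderiv ℝ u x (Pi.single α Complex.I, 0)) / 2

/-- The derivative `v u` of the complex-valued function `u` at `x` along the complex tangent
vector `v`. -/
noncomputable def act (v : CTan ι) (u : Pt ι → ℂ) (x : Pt ι) : ℂ :=
  (∑ α, (v.1 α * dz u x α + v.2.1 α * dzbar u x α)) + v.2.2 * fderiv ℝ u x (0, 1)

/-- Complex conjugation of complex tangent vectors. -/
noncomputable def conjVec (v : CTan ι) : CTan ι :=
  (fun α => conj (v.2.1 α), fun α => conj (v.1 α), conj v.2.2)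

/-- The Lie bracket of complex vector fields. -/
noncomputable def bracket (X Y : Pt ι → CTan ι) (x : Pt ι) : CTan ι :=
  (fun α => act (X x) (fun y => (Y y).1 α) x - act (Y x) (fun y => (X y).1 α) x,
   fun α => act (X x) (fun y => (Y y).2.1 α) x - act (Y x) (fun y => (X y).2.1 α) x,
   act (X x) (fun y => (Y y).2.2) x - act (Y x) (fun y => (X y).2.2) x)

/-- The tangent mapping `f_*` at `x`, extended complex linearly; the components of `f_* v` are
the derivatives along `v` of the functions `z^α ∘ f`, `z̄^α ∘ f` and `t ∘ f`. -/
noncomputable def pushforward (f : Pt ι → Pt ι) (x : Pt ι) (v : CTan ι) : CTan ι :=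
  (fun α => act v (fun y => (f y).1 α) x,
   fun α => act v (fun y => conj ((f y).1 α)) x,
   act v (fun y => ((f y).2 : ℂ)) x)

/-! ### The pseudohermitian structure of the hypersurface `Im z^{n+1} = p(z)` -/

/-- The restriction to the hypersurface of the coordinate `z^{n+1} = t + i p(z)`. -/
noncomputable def zLast (p : (ι → ℂ) → ℝ) (x : Pt ι) : ℂ :=
  (x.2 : ℂ) + Complex.I * (p x.1 : ℂ)

/-- `p_α = ∂p/∂z^α`. -/
noncomputable def pz (p : (ι → ℂ) → ℝ) (x : Pt ι) (α : ι) : ℂ :=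
  dz (fun y => (p y.1 : ℂ)) x α

/-- `p_ᾱ = ∂p/∂z̄^α`. -/
noncomputable def pzbar (p : (ι → ℂ) → ℝ) (x : Pt ι) (α : ι) : ℂ :=
  dzbar (fun y => (p y.1 : ℂ)) x α

/-- The holomorphic tangent space `T^{1,0}` at `x`: complex vectors tangent to the hypersurface
that are of type `(1,0)` in `ℂⁿ⁺¹`, i.e. that annihilate the antiholomorphic coordinates
`z̄^α` and `z̄^{n+1}`. -/
noncomputable def holTangent (p : (ι → ℂ) → ℝ) (x : Pt ι) : Submodule ℂ (CTan ι) where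
  carrier := {v | (∀ α, act v (fun y => conj (y.1 α)) x = 0) ∧
    act v (fun y => conj (zLast p y)) x = 0}
  zero_mem' := by simp [act]
  add_mem' := by
    have key : ∀ (v w : CTan ι) (u : Pt ι → ℂ), act (v + w) u x = act v u x + act w u x := by
      intro v w u
      simp only [act, Prod.fst_add, Prod.snd_add, Pi.add_apply, add_mul, Finset.sum_add_distrib]
      ring
    rintro v w ⟨hv, hv'⟩ ⟨hw, hw'⟩
    exact ⟨fun α => by rw [key, hv, hw, add_zero], by rw [key, hv', hw', add_zero]⟩
  smul_mem' := by
    have key : ∀ (c : ℂ) (v : CTan ι) (u : Pt ι → ℂ), act (c • v) u x = c * act v u x := by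
      intro c v u
      simp only [act, Prod.smul_fst, Prod.smul_snd, Pi.smul_apply, smul_eq_mul, mul_add,
        Finset.mul_sum, mul_assoc]
    rintro c v ⟨hv, hv'⟩
    exact ⟨fun α => by rw [key, hv, mul_zero], by rw [key, hv', mul_zero]⟩

/-- The contact form `ϑ = dt - i (p_α dz^α - p_ᾱ dz̄^α)`, extended complex linearly. -/
noncomputable def theta (p : (ι → ℂ) → ℝ) (x : Pt ι) (v : CTan ι) : ℂ :=
  v.2.2 - Complex.I * ∑ α, (pz p x α * v.1 α - pzbar p x α * v.2.1 α)

/-- The exterior derivative `dϑ(v, w) = v(ϑ(w)) - w(ϑ(v)) - ϑ([v, w])`, computed by extending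
the vectors `v`, `w` with constant coefficients (so that the bracket vanishes). -/
noncomputable def dtheta (p : (ι → ℂ) → ℝ) (x : Pt ι) (v w : CTan ι) : ℂ :=
  act v (fun y => theta p y w) x - act w (fun y => theta p y v) x

/-- The Levi form `L = -i dϑ`; its value on vectors `Z`, `W` of type `(1,0)` is
`levi p x Z (conjVec W)`. -/
noncomputable def levi (p : (ι → ℂ) → ℝ) (x : Pt ι) (v w : CTan ι) : ℂ :=
  -Complex.I * dtheta p x v w

/-- The holomorphic frame `Z_α = ∂_α + i p_α ∂_t`. -/
noncomputable def frameZ (p : (ι → ℂ) → ℝ) (α : ι) (x : Pt ι) : CTan ι :=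
  (Pi.single α 1, 0, Complex.I * pz p x α)

/-- `Z_ᾱ`, the conjugate of `Z_α`. -/
noncomputable def frameZbar (p : (ι → ℂ) → ℝ) (α : ι) (x : Pt ι) : CTan ι :=
  conjVec (frameZ p α x)

/-- The characteristic vector field `T = ∂_t` of `ϑ`. -/
def reeb (_x : Pt ι) : CTan ι := (0, 0, 1)

/-- `h_{αβ̄} = L(Z_α, Z_β̄)`. -/
noncomputable def leviMatrix (p : (ι → ℂ) → ℝ) (x : Pt ι) : Matrix ι ι ℂ :=
  Matrix.of fun α β => levi p x (frameZ p α x) (frameZbar p β x)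

/-- `h^{αβ̄}`, determined by `∑_β h^{αβ̄} h_{γβ̄} = δ_γ^α`. -/
noncomputable def leviInv (p : (ι → ℂ) → ℝ) (x : Pt ι) : Matrix ι ι ℂ :=
  ((leviMatrix p x).transpose)⁻¹

/-! ### Tanaka--Webster connection and curvature -/

/-- The projection onto `T^{1,0}` along `T^{0,1} ⊕ ℂT`, applied to a vector field. -/
noncomputable def projHol (p : (ι → ℂ) → ℝ) (X : Pt ι → CTan ι) (x : Pt ι) : CTan ι :=
  ∑ α, (X x).1 α • frameZ p α x

/-- The projection onto `T^{0,1}` along `T^{1,0} ⊕ ℂT`, applied to a vector field. -/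
noncomputable def projAnti (p : (ι → ℂ) → ℝ) (X : Pt ι → CTan ι) (x : Pt ι) : CTan ι :=
  ∑ α, (X x).2.1 α • frameZbar p α x

/-- The Tanaka--Webster connection of `ϑ` on sections `V` of `T^{1,0}`. Write
`X = X⁺ + X⁻ + ϑ(X) T` for the decomposition of `X` along `T^{1,0} ⊕ T^{0,1} ⊕ ℂT`. Then
`∇_X V = ∇_{X⁺} V + π₊[X⁻, V] + ϑ(X) π₊[T, V]`, where the section `∇_{X⁺} V` of `T^{1,0}` is the
one with `L(∇_{X⁺} V, W̄) = X⁺ L(V, W̄) - L(V, ∇_{X⁺} W̄)`, `∇_{X⁺} W̄ = π₋[X⁺, W̄]`, for all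
sections `W` of `T^{1,0}`; below it is solved for in the frame `Z_σ`, with `W = Z_β`. -/
noncomputable def webster (p : (ι → ℂ) → ℝ) (X V : Pt ι → CTan ι) (x : Pt ι) : CTan ι :=
  (∑ σ, (∑ β, leviInv p x σ β *
      (act (projHol p X x) (fun y => levi p y (V y) (frameZbar p β y)) x
        - levi p x (V x) (projAnti p (bracket (projHol p X) (frameZbar p β)) x)))
      • frameZ p σ x)
    + projHol p (bracket (projAnti p X) V) x
    + theta p x (X x) • projHol p (bracket reeb V) x

/-- The curvature operator `R(X, Y) V = ∇_X ∇_Y V - ∇_Y ∇_X V - ∇_{[X, Y]} V`. -/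
noncomputable def curvOp (p : (ι → ℂ) → ℝ) (X Y V : Pt ι → CTan ι) (x : Pt ι) : CTan ι :=
  webster p X (webster p Y V) x - webster p Y (webster p X V) x
    - webster p (bracket X Y) V x

/-- `R_{αβ̄λμ̄} = L(R(Z_λ, Z_μ̄) Z_α, Z_β̄)`. -/
noncomputable def curvComp (p : (ι → ℂ) → ℝ) (x : Pt ι) (α β l μ : ι) : ℂ :=
  levi p x (curvOp p (frameZ p l) (frameZbar p μ) (frameZ p α) x) (frameZbar p β x)

/-- `R_{αμ̄} = R_α{}^λ{}_{λμ̄} = ∑ h^{λβ̄} R_{αβ̄λμ̄}`. -/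
noncomputable def ricciComp (p : (ι → ℂ) → ℝ) (x : Pt ι) (α μ : ι) : ℂ :=
  ∑ l, ∑ β, leviInv p x l β * curvComp p x α β l μ

/-- The pseudohermitian Ricci tensor: for `v = ∑ v^α Z_α` in `T^{1,0}` and
`w = ∑ w^μ Z_μ̄` in `T^{0,1}`, `Ric(v, w) = ∑ R_{αμ̄} v^α w^μ`. -/
noncomputable def ricci (p : (ι → ℂ) → ℝ) (x : Pt ι) (v w : CTan ι) : ℂ :=
  ∑ α, ∑ μ, ricciComp p x α μ * v.1 α * w.2.1 μ

/-- The pseudohermitian scalar curvature `R = ∑ h^{αμ̄} R_{αμ̄}`. -/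
noncomputable def scalarCurv (p : (ι → ℂ) → ℝ) (x : Pt ι) : ℂ :=
  ∑ α, ∑ μ, leviInv p x α μ * ricciComp p x α μ

/-! ### CR diffeomorphisms -/

/-- `f` restricts to a (smooth) CR diffeomorphism of `N` onto `N'`, with CR factor `lam`. -/
structure IsCRDiffeo (p : (ι → ℂ) → ℝ) (f : Pt ι → Pt ι) (N N' : Set (Pt ι))
    (lam : Pt ι → ℝ) : Prop where
  smooth : ContDiffOn ℝ ∞ f N
  mapsTo : Set.MapsTo f N N'
  exists_inverse : ∃ g : Pt ι → Pt ι, ContDiffOn ℝ ∞ g N' ∧ Set.MapsTo g N' N ∧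
    Set.InvOn g f N N'
  /-- `f_*` maps `T^{1,0}` into `T^{1,0}`: it preserves the complex structure. -/
  map_hol : ∀ x ∈ N, ∀ v ∈ holTangent p x, pushforward f x v ∈ holTangent p (f x)
  factor_pos : ∀ x ∈ N, 0 < lam x
  /-- `f^* ϑ = lam ϑ`. -/
  pullback_theta : ∀ x ∈ N, ∀ v : CTan ι,
    theta p (f x) (pushforward f x v) = (lam x : ℂ) * theta p x v

end General

/-! ### The generalized ellipsoid model

There are `s = k + 1` groups of variables, the `j`-th one with `d j` variables; the index
`Fin.last k` is the distinguished last group, whose exponent is `1`. -/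

section Ellipsoid

variable {k : ℕ}

/-- The indexes of the variables; the `j`-th block is `I_j`. -/
abbrev Idx (d : Fin (k + 1) → ℕ) : Type := Σ j : Fin (k + 1), Fin (d j)

/-- `|z_j|²`. -/
noncomputable def groupSq (d : Fin (k + 1) → ℕ) (j : Fin (k + 1)) (z : Idx d → ℂ) : ℝ :=
  ∑ a : Fin (d j), ‖z ⟨j, a⟩‖ ^ 2

/-- `p(z) = ∑_j |z_j|^{2 m_j}`. -/
noncomputable def ellP (m d : Fin (k + 1) → ℕ) (z : Idx d → ℂ) : ℝ :=
  ∑ j, groupSq d j z ^ m j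

/-- The strictly pseudoconvex part `M` of the hypersurface: `z_j ≠ 0` for all `j` but the last. -/
def ellM (d : Fin (k + 1) → ℕ) : Set (Pt (Idx d)) :=
  {x | ∀ j, j ≠ Fin.last k → groupSq d j x.1 ≠ 0}

/-- The radial field `E_j = (1 / m_j) ∑_{α ∈ I_j} z^α Z_α` (zero if `I_j` is empty). -/
noncomputable def radialE (m d : Fin (k + 1) → ℕ) (j : Fin (k + 1)) (x : Pt (Idx d)) :
    CTan (Idx d) :=
  ((1 : ℂ) / (m j : ℂ)) • ∑ a : Fin (d j), x.1 ⟨j, a⟩ • frameZ (ellP m d) ⟨j, a⟩ x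

/-- The span of the `E_j` at `x`. -/
noncomputable def bundleE (m d : Fin (k + 1) → ℕ) (x : Pt (Idx d)) :
    Submodule ℂ (CTan (Idx d)) :=
  Submodule.span ℂ (Set.range fun j => radialE m d j x)

/-- The projection `Q(Z) = Z - ∑_j (L(Z, Ē_j) / L(E_j, Ē_j)) E_j`. Where `E_j = 0` (on `M` this
happens at most for the last group) the corresponding term is zero. -/
noncomputable def projQ (m d : Fin (k + 1) → ℕ) (x : Pt (Idx d)) (v : CTan (Idx d)) :
    CTan (Idx d) :=
  v - ∑ j, (levi (ellP m d) x v (conjVec (radialE m d j x)) /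
    levi (ellP m d) x (radialE m d j x) (conjVec (radialE m d j x))) • radialE m d j x

/-- `𝒲_j`, the span at `x` of the `W_α = Q(Z_α)` with `α ∈ I_j`. -/
noncomputable def bundleW (m d : Fin (k + 1) → ℕ) (j : Fin (k + 1)) (x : Pt (Idx d)) :
    Submodule ℂ (CTan (Idx d)) :=
  Submodule.span ℂ
    (Set.range fun a : Fin (d j) => projQ m d x (frameZ (ellP m d) ⟨j, a⟩ x))

/-- `ℰ ⊕ 𝒲_s` at `x`; everywhere on `M` it is the span of `E_1, …, E_{s-1}` and of the `Z_α` with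
`α` in the last group. -/
noncomputable def bundleEW (m d : Fin (k + 1) → ℕ) (x : Pt (Idx d)) :
    Submodule ℂ (CTan (Idx d)) :=
  bundleE m d x ⊔ bundleW m d (Fin.last k) x

end Ellipsoid

end RigidCR

/-!
Write `h` for the Levi form, `∇` for the Tanaka--Webster connection and `R` for its curvature.

On a rigid hypersurface the characteristic field `T = ∂_t` commutes with the frame `Z_α`, so the
connection matrices are `Γ_l = h⁻¹ Z_l h`, and the curvature endomorphism `R(Z_l, Z_μ̄)` of
`T^{1,0}` has the matrix `-Z_μ̄ Γ_l` (`curvOp_frame`). The Ricci tensor is a trace of it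
(`ricciComp_eq`).

Let `f` be a CR diffeomorphism with factor `lam`, let `J^γ_α = Z_α (z^γ ∘ f)` be its differential
on `T^{1,0}`, and put `u = log lam`, `u_α = Z_α u`, `u_{αμ̄} = Z_μ̄ Z_α u`. Applying the
commutators `[Z_α, Z_β̄] = -i h_{αβ̄} T` and `[T, Z_α] = 0` to the components of `f` gives
`f^* h = lam h` (`leviMatrix_pullback`) and identifies the `T^{1,0}` part of `f_* T` with the
gradient of `lam` (`zOp_clam`). Differentiating `f^* h = lam h` along `Z_ε` shows that
`f^* ∇ - ∇` is the tensor `u_ε δ^σ_α + u_α δ^σ_ε` (`zOp_jac`), and differentiating once more,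
along `Z_μ̄`, yields
`f^* R - R = h_{εμ̄} B_α + h_{αμ̄} B_ε - J_α u_{εμ̄} - J_ε u_{αμ̄}` for a certain tensor `B`
(`pullCurv_sub`). This is the form in which the invariance of the Chern--Moser tensor is used.

The right side is rigid: if it is annihilated by a single vector `X` with `h(X, X̄) ≠ 0`, then
`B = c J` and `u_{εμ̄} = c h_{εμ̄}` with the same constant `c`, and the right side vanishes
(`eq_zero_of_annihilated`). Here it matters that `u`, being real, has a complex Hessian that is
Hermitian modulo `h` (`conj_zbOp_logGrad`).

For the generalized ellipsoid, `h` is positive definite on `M` (`levi_ellP_ne_zero`), and every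
vector of `ℰ ⊕ 𝒲_s` annihilates the curvature (`bundleEW_le_curvNull`): the block of `h`
belonging to `z_j` is homogeneous of degree `m_j - 1` in `z_j`, so `∑_{α ∈ I_j} z^α Γ_α` is a
constant matrix, while the variables of the last group do not enter `h`. As `f_*` maps `ℰ ⊕ 𝒲_s`
into itself, any nonzero `X` in this bundle annihilates both `R` and `f^* R`. Therefore
`f^* R = R` as endomorphism-valued forms; taking traces, with `f^* h = lam h`, gives both
assertions.
-/

set_option linter.unusedSectionVars false

namespace RigidCR

/-! ### Calculus of complexified tangent vectors -/

section Calculus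

variable {ι : Type} [Fintype ι] [DecidableEq ι]

/-- `v u` depends complex linearly on the differential of `u`. -/
theorem act_lincomb {κ : Type*} (s : Finset κ) (v : CTan ι) (u : Pt ι → ℂ) (x : Pt ι)
    (c : κ → ℂ) (w : κ → Pt ι → ℂ)
    (h : ∀ e, fderiv ℝ u x e = ∑ i ∈ s, c i * fderiv ℝ (w i) x e) :
    act v u x = ∑ i ∈ s, c i * act v (w i) x := by
  have e1 : ∀ α, dz u x α = ∑ i ∈ s, c i * dz (w i) x α := by
    intro α
    simp only [dz, h, Finset.mul_sum, ← Finset.sum_sub_distrib, Finset.sum_div]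
    exact Finset.sum_congr rfl fun i _ => by ring
  have e2 : ∀ α, dzbar u x α = ∑ i ∈ s, c i * dzbar (w i) x α := by
    intro α
    simp only [dzbar, h, Finset.mul_sum, ← Finset.sum_add_distrib, Finset.sum_div]
    exact Finset.sum_congr rfl fun i _ => by ring
  simp only [act, e1, e2, h, mul_add, Finset.mul_sum, Finset.sum_add_distrib]
  rw [Finset.sum_comm (s := Finset.univ), Finset.sum_comm (s := Finset.univ)]
  congr 1
  · congr 1
    all_goals
      exact Finset.sum_congr rfl fun i _ => Finset.sum_congr rfl fun α _ => by ring
  · exact Finset.sum_congr rfl fun i _ => by ring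

theorem act_congr_of_fderiv (v : CTan ι) {u w : Pt ι → ℂ} {x : Pt ι}
    (h : ∀ e, fderiv ℝ u x e = fderiv ℝ w x e) : act v u x = act v w x := by
  simp only [act, dz, dzbar, h]

theorem act_congr (v : CTan ι) {u w : Pt ι → ℂ} {x : Pt ι} {N : Set (Pt ι)} (hN : IsOpen N)
    (hx : x ∈ N) (h : ∀ y ∈ N, u y = w y) : act v u x = act v w x := by
  apply act_congr_of_fderiv
  intro e
  have : u =ᶠ[nhds x] w := Filter.eventually_of_mem (hN.mem_nhds hx) h
  rw [this.fderiv_eq]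

theorem act_const (v : CTan ι) (c : ℂ) (x : Pt ι) : act v (fun _ => c) x = 0 := by
  simp [act, dz, dzbar]

theorem act_lincomb_two (v : CTan ι) (u w₁ w₂ : Pt ι → ℂ) (x : Pt ι) (c₁ c₂ : ℂ)
    (h : ∀ e, fderiv ℝ u x e = c₁ * fderiv ℝ w₁ x e + c₂ * fderiv ℝ w₂ x e) :
    act v u x = c₁ * act v w₁ x + c₂ * act v w₂ x := by
  have := act_lincomb Finset.univ v u x ![c₁, c₂] ![w₁, w₂]
    (by intro e; simp [Fin.sum_univ_two, h])
  simpa [Fin.sum_univ_two] using this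

theorem act_mul (v : CTan ι) {u w : Pt ι → ℂ} {x : Pt ι} (hu : DifferentiableAt ℝ u x)
    (hw : DifferentiableAt ℝ w x) :
    act v (fun y => u y * w y) x = act v u x * w x + u x * act v w x := by
  rw [act_lincomb_two v _ u w x (w x) (u x)]
  · ring
  · intro e
    rw [fderiv_fun_mul hu hw]
    simp only [add_apply, smul_apply, smul_eq_mul]
    ring

theorem act_add (v : CTan ι) {u w : Pt ι → ℂ} {x : Pt ι} (hu : DifferentiableAt ℝ u x)
    (hw : DifferentiableAt ℝ w x) :
    act v (fun y => u y + w y) x = act v u x + act v w x := by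
  rw [act_lincomb_two v _ u w x 1 1, one_mul, one_mul]
  intro e
  simp [fderiv_fun_add hu hw]

theorem act_sub (v : CTan ι) {u w : Pt ι → ℂ} {x : Pt ι} (hu : DifferentiableAt ℝ u x)
    (hw : DifferentiableAt ℝ w x) :
    act v (fun y => u y - w y) x = act v u x - act v w x := by
  rw [act_lincomb_two v _ u w x 1 (-1)]
  · ring
  · intro e
    simp only [fderiv_fun_sub hu hw, sub_apply]
    ring

theorem act_const_mul (v : CTan ι) {u : Pt ι → ℂ} {x : Pt ι} (c : ℂ)
    (hu : DifferentiableAt ℝ u x) :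
    act v (fun y => c * u y) x = c * act v u x := by
  rw [act_mul v (differentiableAt_const c) hu, act_const]
  ring

theorem act_sum {κ : Type*} (s : Finset κ) (v : CTan ι) {u : κ → Pt ι → ℂ} {x : Pt ι}
    (hu : ∀ i ∈ s, DifferentiableAt ℝ (u i) x) :
    act v (fun y => ∑ i ∈ s, u i y) x = ∑ i ∈ s, act v (u i) x := by
  rw [act_lincomb s v _ x (fun _ => 1) u]
  · simp
  · intro e
    rw [fderiv_fun_sum hu]
    simp

theorem act_pow (v : CTan ι) {u : Pt ι → ℂ} {x : Pt ι} (n : ℕ)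
    (hu : DifferentiableAt ℝ u x) :
    act v (fun y => u y ^ n) x = n * u x ^ (n - 1) * act v u x := by
  rw [act_lincomb_two v _ u u x (n * u x ^ (n - 1)) 0]
  · ring
  · intro e
    rw [fderiv_fun_pow n hu]
    simp [mul_assoc]

theorem fderiv_conj_apply (u : Pt ι → ℂ) (x e : Pt ι) :
    fderiv ℝ (fun y => conj (u y)) x e = conj (fderiv ℝ u x e) := by
  have := Complex.conjCLE.comp_fderiv (f := u) (x := x)
  exact congrArg (fun L => L e) this

theorem act_conj (v : CTan ι) (u : Pt ι → ℂ) (x : Pt ι) :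
    act v (fun y => conj (u y)) x = conj (act (conjVec v) u x) := by
  simp only [act, dz, dzbar, fderiv_conj_apply, conjVec, map_add, map_sum, map_mul, map_div₀,
    map_sub, Complex.conj_conj, Complex.conj_I, map_ofNat]
  congr 1
  refine Finset.sum_congr rfl fun α _ => ?_
  ring

theorem act_add_vec (v w : CTan ι) (u : Pt ι → ℂ) (x : Pt ι) :
    act (v + w) u x = act v u x + act w u x := by
  simp only [act, Prod.fst_add, Prod.snd_add, Pi.add_apply, add_mul, Finset.sum_add_distrib]
  ring

theorem act_smul_vec (c : ℂ) (v : CTan ι) (u : Pt ι → ℂ) (x : Pt ι) :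
    act (c • v) u x = c * act v u x := by
  simp only [act, Prod.smul_fst, Prod.smul_snd, Pi.smul_apply, smul_eq_mul, mul_add,
    Finset.mul_sum, mul_assoc]

theorem act_zero_vec (u : Pt ι → ℂ) (x : Pt ι) : act (0 : CTan ι) u x = 0 := by
  simp [act]

theorem act_sum_vec {κ : Type*} (s : Finset κ) (v : κ → CTan ι) (u : Pt ι → ℂ) (x : Pt ι) :
    act (∑ i ∈ s, v i) u x = ∑ i ∈ s, act (v i) u x := by
  classical
  induction s using Finset.induction_on with
  | empty => simp [act_zero_vec]
  | insert a s ha ih => rw [Finset.sum_insert ha, Finset.sum_insert ha, act_add_vec, ih]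

/-- A real linear form on `ℂⁿ × ℝ` in terms of its `dz`, `dz̄` and `dt` components. -/
theorem fderiv_eq_dz_dzbar (u : Pt ι → ℂ) (x e : Pt ι) :
    fderiv ℝ u x e = (∑ α, (dz u x α * e.1 α + dzbar u x α * conj (e.1 α)))
      + fderiv ℝ u x (0, 1) * e.2 := by
  set L := fderiv ℝ u x
  have h1 : e = (∑ α, ((e.1 α).re • ((Pi.single α 1, 0) : Pt ι)
      + (e.1 α).im • ((Pi.single α Complex.I, 0) : Pt ι))) + e.2 • ((0, 1) : Pt ι) := by
    apply Prod.ext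
    · funext β
      simp only [Prod.fst_add, Prod.fst_sum, Prod.smul_fst, Pi.add_apply, Finset.sum_apply,
        Pi.smul_apply, Pi.single_apply, smul_ite, smul_zero, Finset.sum_add_distrib,
        Finset.sum_ite_eq, Finset.mem_univ, if_true, Complex.real_smul]
      simp [Complex.re_add_im]
    · simp [Prod.snd_sum]
  conv_lhs => rw [h1]
  rw [map_add, map_sum, map_smul]
  congr 1
  · refine Finset.sum_congr rfl fun α _ => ?_
    rw [map_add, map_smul, map_smul]
    simp only [dz, dzbar, Complex.real_smul]
    have h2 : conj (e.1 α) = (e.1 α).re - (e.1 α).im * Complex.I := by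
      apply Complex.ext <;> simp
    conv_rhs => rw [h2, ← Complex.re_add_im (e.1 α)]
    ring_nf
    rw [Complex.I_sq]
    simp
    ring
  · simp [mul_comm]

/-- The chain rule. -/
theorem act_comp (v : CTan ι) {u : Pt ι → ℂ} {f : Pt ι → Pt ι} {x : Pt ι}
    (hu : DifferentiableAt ℝ u (f x)) (hf : DifferentiableAt ℝ f x) :
    act v (fun y => u (f y)) x = act (pushforward f x v) u (f x) := by
  have hF : ∀ α e, fderiv ℝ (fun y => (f y).1 α) x e = (fderiv ℝ f x e).1 α := by
    intro α e
    have : HasFDerivAt (fun y => (f y).1 α)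
        (((ContinuousLinearMap.proj α).comp
          (ContinuousLinearMap.fst ℝ (ι → ℂ) ℝ)).comp (fderiv ℝ f x)) x :=
      ((ContinuousLinearMap.proj (R := ℝ) (φ := fun _ : ι => ℂ) α).comp
        (ContinuousLinearMap.fst ℝ (ι → ℂ) ℝ)).hasFDerivAt.comp x hf.hasFDerivAt
    rw [this.fderiv]; rfl
  have hT : ∀ e, fderiv ℝ (fun y => ((f y).2 : ℂ)) x e = ((fderiv ℝ f x e).2 : ℂ) := by
    intro e
    have : HasFDerivAt (fun y => ((f y).2 : ℂ))
        ((Complex.ofRealCLM.comp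
          (ContinuousLinearMap.snd ℝ (ι → ℂ) ℝ)).comp (fderiv ℝ f x)) x :=
      (Complex.ofRealCLM.comp
        (ContinuousLinearMap.snd ℝ (ι → ℂ) ℝ)).hasFDerivAt.comp x hf.hasFDerivAt
    rw [this.fderiv]; rfl
  have key := act_lincomb (Finset.univ : Finset ((ι ⊕ ι) ⊕ Unit)) v (fun y => u (f y)) x
    (Sum.elim (Sum.elim (dz u (f x)) (dzbar u (f x))) (fun _ => fderiv ℝ u (f x) (0, 1)))
    (Sum.elim (Sum.elim (fun α y => (f y).1 α) (fun α y => conj ((f y).1 α)))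
      (fun _ y => ((f y).2 : ℂ)))
    (by
      intro e
      have h1 : fderiv ℝ (fun y => u (f y)) x = (fderiv ℝ u (f x)).comp (fderiv ℝ f x) :=
        fderiv_comp x hu hf
      rw [h1, ContinuousLinearMap.comp_apply, fderiv_eq_dz_dzbar]
      simp only [Fintype.sum_sum_type, Sum.elim_inl, Sum.elim_inr, Finset.sum_const,
        Finset.card_univ, Fintype.card_unit, one_smul, fderiv_conj_apply, hF, hT,
        Finset.sum_add_distrib])
  rw [key]
  simp only [Fintype.sum_sum_type, Sum.elim_inl, Sum.elim_inr, Finset.sum_const,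
        Finset.card_univ, Fintype.card_unit, one_smul, act, pushforward, Finset.sum_add_distrib]
  simp only [mul_comm]

theorem conjVec_conjVec (v : CTan ι) : conjVec (conjVec v) = v := by
  simp [conjVec]

theorem pushforward_conjVec (f : Pt ι → Pt ι) (x : Pt ι) (v : CTan ι) :
    pushforward f x (conjVec v) = conjVec (pushforward f x v) := by
  have h2 : act (conjVec v) (fun y => ((f y).2 : ℂ)) x
      = conj (act v (fun y => ((f y).2 : ℂ)) x) := by
    have := act_conj (conjVec v) (fun y => ((f y).2 : ℂ)) x
    simpa [conjVec_conjVec] using this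
  refine Prod.ext ?_ (Prod.ext ?_ h2)
  · funext α
    simp only [pushforward, conjVec, act_conj, Complex.conj_conj]
  · funext α
    simp only [pushforward]
    rw [act_conj, conjVec_conjVec]
    rfl

theorem contDiffOn_fderiv_apply {u : Pt ι → ℂ} {N : Set (Pt ι)} (hN : IsOpen N)
    (hu : ContDiffOn ℝ ∞ u N) (e : Pt ι) :
    ContDiffOn ℝ ∞ (fun y => fderiv ℝ u y e) N :=
  (hu.fderiv_of_isOpen hN (by norm_num)).clm_apply contDiffOn_const

theorem fderiv_fderiv_comm {u : Pt ι → ℂ} {N : Set (Pt ι)} (hN : IsOpen N)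
    (hu : ContDiffOn ℝ ∞ u N) {x : Pt ι} (hx : x ∈ N) (e e' : Pt ι) :
    fderiv ℝ (fun y => fderiv ℝ u y e) x e' = fderiv ℝ (fun y => fderiv ℝ u y e') x e := by
  have hc : ContDiffAt ℝ ∞ u x := hu.contDiffAt (hN.mem_nhds hx)
  have hs : IsSymmSndFDerivAt ℝ u x :=
    hc.isSymmSndFDerivAt (by simpa using WithTop.coe_le_coe.2 (le_top : (2 : ℕ∞) ≤ ⊤))
  have hd : DifferentiableAt ℝ (fderiv ℝ u) x :=
    ((hu.fderiv_of_isOpen hN (m := ∞) (by norm_num)).contDiffAt (hN.mem_nhds hx)).differentiableAt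
      (by simp)
  have h1 : ∀ a b, fderiv ℝ (fun y => fderiv ℝ u y a) x b = fderiv ℝ (fderiv ℝ u) x b a := by
    intro a b
    rw [fderiv_clm_apply hd (differentiableAt_const _)]
    simp
  rw [h1, h1]
  exact hs e' e

theorem contDiffOn_conj {u : Pt ι → ℂ} {N : Set (Pt ι)} (hu : ContDiffOn ℝ ∞ u N) :
    ContDiffOn ℝ ∞ (fun y => conj (u y)) N :=
  Complex.conjCLE.contDiff.comp_contDiffOn hu

theorem contDiffOn_dz {u : Pt ι → ℂ} {N : Set (Pt ι)} (hN : IsOpen N)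
    (hu : ContDiffOn ℝ ∞ u N) (α : ι) : ContDiffOn ℝ ∞ (fun y => dz u y α) N :=
  ((contDiffOn_fderiv_apply hN hu _).sub
    (contDiffOn_const.mul (contDiffOn_fderiv_apply hN hu _))).div_const 2

theorem contDiffOn_dzbar {u : Pt ι → ℂ} {N : Set (Pt ι)} (hN : IsOpen N)
    (hu : ContDiffOn ℝ ∞ u N) (α : ι) : ContDiffOn ℝ ∞ (fun y => dzbar u y α) N :=
  ((contDiffOn_fderiv_apply hN hu _).add
    (contDiffOn_const.mul (contDiffOn_fderiv_apply hN hu _))).div_const 2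

/-- Vectors with constant coefficients commute as differential operators. -/
theorem act_act_comm_const {u : Pt ι → ℂ} {N : Set (Pt ι)} (hN : IsOpen N)
    (hu : ContDiffOn ℝ ∞ u N) {x : Pt ι} (hx : x ∈ N) (v w : CTan ι) :
    act v (fun y => act w u y) x = act w (fun y => act v u y) x := by
  have hd : ∀ {g : Pt ι → ℂ}, ContDiffOn ℝ ∞ g N → DifferentiableAt ℝ g x := fun hg =>
    (hg.contDiffAt (hN.mem_nhds hx)).differentiableAt (by simp)
  have hde : ∀ e, DifferentiableAt ℝ (fun y => fderiv ℝ u y e) x := fun e =>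
    hd (contDiffOn_fderiv_apply hN hu e)
  -- the case of a real constant vector `e`
  have expand : ∀ (w : CTan ι) (e : Pt ι), fderiv ℝ (fun y => act w u y) x e
      = act w (fun y => fderiv ℝ u y e) x := by
    intro w e
    have h1 : ∀ α, HasFDerivAt (fun y => dz u y α)
        ((2 : ℂ)⁻¹ • (fderiv ℝ (fun y => fderiv ℝ u y (Pi.single α 1, 0)) x
          - Complex.I • fderiv ℝ (fun y => fderiv ℝ u y (Pi.single α Complex.I, 0)) x)) x := by
      intro α
      have := (((hde (Pi.single α 1, 0)).hasFDerivAt).sub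
        ((hde (Pi.single α Complex.I, 0)).hasFDerivAt.const_smul Complex.I)).const_smul (2 : ℂ)⁻¹
      refine this.congr_of_eventuallyEq (Filter.Eventually.of_forall fun y => ?_)
      simp only [dz, Pi.smul_apply, Pi.sub_apply, smul_eq_mul]; ring
    have h2 : ∀ α, HasFDerivAt (fun y => dzbar u y α)
        ((2 : ℂ)⁻¹ • (fderiv ℝ (fun y => fderiv ℝ u y (Pi.single α 1, 0)) x
          + Complex.I • fderiv ℝ (fun y => fderiv ℝ u y (Pi.single α Complex.I, 0)) x)) x := by
      intro α
      have := (((hde (Pi.single α 1, 0)).hasFDerivAt).add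
        ((hde (Pi.single α Complex.I, 0)).hasFDerivAt.const_smul Complex.I)).const_smul (2 : ℂ)⁻¹
      refine this.congr_of_eventuallyEq (Filter.Eventually.of_forall fun y => ?_)
      simp only [dzbar, Pi.smul_apply, Pi.add_apply, smul_eq_mul]; ring
    have h3 := (HasFDerivAt.fun_sum (u := Finset.univ) fun α _ =>
      ((h1 α).const_smul (w.1 α)).add ((h2 α).const_smul (w.2.1 α))).add
      ((hde (0, 1)).hasFDerivAt.const_smul w.2.2)
    have h4 : fderiv ℝ (fun y => act w u y) x = _ := HasFDerivAt.fderiv h3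
    rw [h4]
    simp only [act, dz, dzbar, add_apply, sub_apply, smul_apply,
      sum_apply, smul_eq_mul]
    congr 1
    · refine Finset.sum_congr rfl fun α _ => ?_
      rw [fderiv_fderiv_comm hN hu hx (Pi.single α 1, 0) e,
        fderiv_fderiv_comm hN hu hx (Pi.single α Complex.I, 0) e]
      ring
    · rw [fderiv_fderiv_comm hN hu hx (0, 1) e]
  have h5 : ∀ α, dz (fun y => act w u y) x α = act w (fun y => dz u y α) x := by
    intro α
    rw [dz, expand, expand]
    have := act_const_mul w (1/2) (u := fun y => fderiv ℝ u y (Pi.single α 1, 0)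
      - Complex.I * fderiv ℝ u y (Pi.single α Complex.I, 0)) (x := x)
      ((hde _).sub ((hde _).const_mul _))
    rw [act_sub w (hde _) ((hde _).const_mul _), act_const_mul w _ (hde _)] at this
    rw [show (fun y => dz u y α) = fun y => (1/2 : ℂ) * (fderiv ℝ u y (Pi.single α 1, 0)
      - Complex.I * fderiv ℝ u y (Pi.single α Complex.I, 0)) by funext y; simp [dz]; ring, this]
    ring
  have h6 : ∀ α, dzbar (fun y => act w u y) x α = act w (fun y => dzbar u y α) x := by
    intro α
    rw [dzbar, expand, expand]
    have := act_const_mul w (1/2) (u := fun y => fderiv ℝ u y (Pi.single α 1, 0)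
      + Complex.I * fderiv ℝ u y (Pi.single α Complex.I, 0)) (x := x)
      ((hde _).add ((hde _).const_mul _))
    rw [act_add w (hde _) ((hde _).const_mul _), act_const_mul w _ (hde _)] at this
    rw [show (fun y => dzbar u y α) = fun y => (1/2 : ℂ) * (fderiv ℝ u y (Pi.single α 1, 0)
      + Complex.I * fderiv ℝ u y (Pi.single α Complex.I, 0)) by funext y; simp [dzbar]; ring, this]
    ring
  have h7 : ∀ α, DifferentiableAt ℝ (fun y => dz u y α) x := fun α => hd (contDiffOn_dz hN hu α)
  have h8 : ∀ α, DifferentiableAt ℝ (fun y => dzbar u y α) x := fun α =>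
    hd (contDiffOn_dzbar hN hu α)
  have lhs : act v (fun y => act w u y) x
      = (∑ α, (v.1 α * act w (fun y => dz u y α) x + v.2.1 α * act w (fun y => dzbar u y α) x))
        + v.2.2 * act w (fun y => fderiv ℝ u y (0, 1)) x := by
    rw [act]
    simp only [h5, h6, expand]
  rw [lhs]
  have h9 : ∀ α, DifferentiableAt ℝ (fun y => v.1 α * dz u y α + v.2.1 α * dzbar u y α) x :=
    fun α => ((h7 α).const_mul _).add ((h8 α).const_mul _)
  have rhs := act_add w (x := x) (u := fun y => ∑ α, (v.1 α * dz u y α + v.2.1 α * dzbar u y α))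
    (w := fun y => v.2.2 * fderiv ℝ u y (0, 1)) (DifferentiableAt.fun_sum fun α _ => h9 α)
    ((hde _).const_mul _)
  rw [act_sum _ w (fun α _ => h9 α), act_const_mul w _ (hde _)] at rhs
  simp only [act_add w ((h7 _).const_mul _) ((h8 _).const_mul _), act_const_mul w _ (h7 _),
    act_const_mul w _ (h8 _)] at rhs
  exact rhs.symm

end Calculus

/-! ### The frame operators and their commutators -/

section Frame

variable {ι : Type} [Fintype ι] [DecidableEq ι]

theorem differentiableAt_of_contDiffOn {u : Pt ι → ℂ} {N : Set (Pt ι)} (hN : IsOpen N)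
    (hu : ContDiffOn ℝ ∞ u N) {x : Pt ι} (hx : x ∈ N) : DifferentiableAt ℝ u x :=
  (hu.contDiffAt (hN.mem_nhds hx)).differentiableAt (by simp)

theorem contDiffOn_act {u : Pt ι → ℂ} {N : Set (Pt ι)} (hN : IsOpen N)
    (hu : ContDiffOn ℝ ∞ u N) {Y : Pt ι → CTan ι}
    (h1 : ∀ α, ContDiffOn ℝ ∞ (fun y => (Y y).1 α) N)
    (h2 : ∀ α, ContDiffOn ℝ ∞ (fun y => (Y y).2.1 α) N)
    (h3 : ContDiffOn ℝ ∞ (fun y => (Y y).2.2) N) :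
    ContDiffOn ℝ ∞ (fun y => act (Y y) u y) N :=
  (ContDiffOn.sum fun α _ => ((h1 α).mul (contDiffOn_dz hN hu α)).add
    ((h2 α).mul (contDiffOn_dzbar hN hu α))).add (h3.mul (contDiffOn_fderiv_apply hN hu _))

/-- The product rule for `Y u`, where `Y` is a vector field. -/
theorem act_act_field {u : Pt ι → ℂ} {N : Set (Pt ι)} (hN : IsOpen N)
    (hu : ContDiffOn ℝ ∞ u N) {x : Pt ι} (hx : x ∈ N) (w : CTan ι) {Y : Pt ι → CTan ι}
    (h1 : ∀ α, DifferentiableAt ℝ (fun y => (Y y).1 α) x)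
    (h2 : ∀ α, DifferentiableAt ℝ (fun y => (Y y).2.1 α) x)
    (h3 : DifferentiableAt ℝ (fun y => (Y y).2.2) x) :
    act w (fun y => act (Y y) u y) x = act w (fun y => act (Y x) u y) x
      + act (fun α => act w (fun y => (Y y).1 α) x, fun α => act w (fun y => (Y y).2.1 α) x,
          act w (fun y => (Y y).2.2) x) u x := by
  have d1 : ∀ α, DifferentiableAt ℝ (fun y => dz u y α) x := fun α =>
    differentiableAt_of_contDiffOn hN (contDiffOn_dz hN hu α) hx
  have d2 : ∀ α, DifferentiableAt ℝ (fun y => dzbar u y α) x := fun α =>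
    differentiableAt_of_contDiffOn hN (contDiffOn_dzbar hN hu α) hx
  have d3 : DifferentiableAt ℝ (fun y => fderiv ℝ u y (0, 1)) x :=
    differentiableAt_of_contDiffOn hN (contDiffOn_fderiv_apply hN hu _) hx
  have key : ∀ {V : Pt ι → CTan ι}, (∀ α, DifferentiableAt ℝ (fun y => (V y).1 α) x) →
      (∀ α, DifferentiableAt ℝ (fun y => (V y).2.1 α) x) →
      DifferentiableAt ℝ (fun y => (V y).2.2) x →
      act w (fun y => act (V y) u y) x = (∑ α,
        ((act w (fun y => (V y).1 α) x * dz u x α + (V x).1 α * act w (fun y => dz u y α) x)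
        + (act w (fun y => (V y).2.1 α) x * dzbar u x α
          + (V x).2.1 α * act w (fun y => dzbar u y α) x)))
        + (act w (fun y => (V y).2.2) x * fderiv ℝ u x (0, 1)
          + (V x).2.2 * act w (fun y => fderiv ℝ u y (0, 1)) x) := by
    intro V v1 v2 v3
    have hs : ∀ α, DifferentiableAt ℝ
        (fun y => (V y).1 α * dz u y α + (V y).2.1 α * dzbar u y α) x :=
      fun α => ((v1 α).mul (d1 α)).add ((v2 α).mul (d2 α))
    have e1 := act_add w (u := fun y => ∑ α, ((V y).1 α * dz u y α + (V y).2.1 α * dzbar u y α))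
      (w := fun y => (V y).2.2 * fderiv ℝ u y (0, 1)) (x := x)
      (DifferentiableAt.fun_sum fun α _ => hs α) (v3.mul d3)
    refine e1.trans ?_
    rw [act_sum _ w (fun α _ => hs α), act_mul w v3 d3]
    congr 1
    refine Finset.sum_congr rfl fun α _ => ?_
    rw [act_add w (u := fun y => (V y).1 α * dz u y α) (w := fun y => (V y).2.1 α * dzbar u y α)
      ((v1 α).mul (d1 α)) ((v2 α).mul (d2 α)), act_mul w (v1 α) (d1 α),
      act_mul w (v2 α) (d2 α)]
  rw [key h1 h2 h3, key (V := fun _ => Y x) (fun α => differentiableAt_const _)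
    (fun α => differentiableAt_const _) (differentiableAt_const _)]
  simp only [act_const, zero_mul, zero_add]
  change _ = _ + ((∑ α, (act w (fun y => (Y y).1 α) x * dz u x α
    + act w (fun y => (Y y).2.1 α) x * dzbar u x α))
    + act w (fun y => (Y y).2.2) x * fderiv ℝ u x (0, 1))
  simp only [Finset.sum_add_distrib]
  ring

/-- The bracket of vector fields is their commutator as differential operators. -/
theorem act_bracket {u : Pt ι → ℂ} {N : Set (Pt ι)} (hN : IsOpen N)
    (hu : ContDiffOn ℝ ∞ u N) {x : Pt ι} (hx : x ∈ N) {X Y : Pt ι → CTan ι}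
    (hX1 : ∀ α, DifferentiableAt ℝ (fun y => (X y).1 α) x)
    (hX2 : ∀ α, DifferentiableAt ℝ (fun y => (X y).2.1 α) x)
    (hX3 : DifferentiableAt ℝ (fun y => (X y).2.2) x)
    (hY1 : ∀ α, DifferentiableAt ℝ (fun y => (Y y).1 α) x)
    (hY2 : ∀ α, DifferentiableAt ℝ (fun y => (Y y).2.1 α) x)
    (hY3 : DifferentiableAt ℝ (fun y => (Y y).2.2) x) :
    act (X x) (fun y => act (Y y) u y) x - act (Y x) (fun y => act (X y) u y) x
      = act (bracket X Y x) u x := by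
  rw [act_act_field hN hu hx _ hY1 hY2 hY3, act_act_field hN hu hx _ hX1 hX2 hX3,
    act_act_comm_const hN hu hx]
  simp only [bracket, act, sub_mul, Finset.sum_add_distrib, Finset.sum_sub_distrib]
  ring

/-- `Z_α` as a differential operator. -/
noncomputable def zOp (p : (ι → ℂ) → ℝ) (α : ι) (u : Pt ι → ℂ) (x : Pt ι) : ℂ :=
  act (frameZ p α x) u x

/-- `Z_ᾱ` as a differential operator. -/
noncomputable def zbOp (p : (ι → ℂ) → ℝ) (α : ι) (u : Pt ι → ℂ) (x : Pt ι) : ℂ :=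
  act (frameZbar p α x) u x

/-- The characteristic field `T` as a differential operator. -/
noncomputable def tOp (u : Pt ι → ℂ) (x : Pt ι) : ℂ := act (reeb x) u x

theorem tOp_eq (u : Pt ι → ℂ) (x : Pt ι) : tOp u x = fderiv ℝ u x (0, 1) := by
  simp [tOp, reeb, act]

theorem conjVec_reeb (x : Pt ι) : conjVec (reeb x) = reeb x := by
  simp [conjVec, reeb, Pi.zero_def]

theorem zOp_conj (p : (ι → ℂ) → ℝ) (α : ι) (u : Pt ι → ℂ) (x : Pt ι) :
    zOp p α (fun y => conj (u y)) x = conj (zbOp p α u x) := act_conj _ _ _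

theorem zbOp_conj (p : (ι → ℂ) → ℝ) (α : ι) (u : Pt ι → ℂ) (x : Pt ι) :
    zbOp p α (fun y => conj (u y)) x = conj (zOp p α u x) := by
  rw [zbOp, act_conj, frameZbar, conjVec_conjVec, zOp]

theorem tOp_conj (u : Pt ι → ℂ) (x : Pt ι) :
    tOp (fun y => conj (u y)) x = conj (tOp u x) := by
  rw [tOp, act_conj, conjVec_reeb, tOp]

variable {p : (ι → ℂ) → ℝ}

theorem contDiff_ofReal_comp_fst (hp : ContDiff ℝ ∞ p) :
    ContDiff ℝ ∞ (fun y : Pt ι => (p y.1 : ℂ)) :=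
  Complex.ofRealCLM.contDiff.comp (hp.comp contDiff_fst)

theorem contDiff_pz (hp : ContDiff ℝ ∞ p) (α : ι) : ContDiff ℝ ∞ (fun y => pz p y α) :=
  contDiffOn_univ.1 (contDiffOn_dz isOpen_univ (contDiff_ofReal_comp_fst hp).contDiffOn α)

theorem contDiff_pzbar (hp : ContDiff ℝ ∞ p) (α : ι) : ContDiff ℝ ∞ (fun y => pzbar p y α) :=
  contDiffOn_univ.1 (contDiffOn_dzbar isOpen_univ (contDiff_ofReal_comp_fst hp).contDiffOn α)

theorem conj_pz (x : Pt ι) (α : ι) : conj (pz p x α) = pzbar p x α := by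
  have h : ∀ e, conj (fderiv ℝ (fun y : Pt ι => (p y.1 : ℂ)) x e)
      = fderiv ℝ (fun y : Pt ι => (p y.1 : ℂ)) x e := by
    intro e
    rw [← fderiv_conj_apply]
    simp only [Complex.conj_ofReal]
  simp only [pz, pzbar, dz, dzbar, map_div₀, map_sub, map_mul, Complex.conj_I, map_ofNat, h]
  ring

theorem conj_pzbar (x : Pt ι) (α : ι) : conj (pzbar p x α) = pz p x α := by
  rw [← conj_pz, Complex.conj_conj]

theorem frameZbar_eq (α : ι) (x : Pt ι) :
    frameZbar p α x = (0, Pi.single α 1, -Complex.I * pzbar p x α) := by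
  rw [frameZbar, frameZ, conjVec]
  refine Prod.ext ?_ (Prod.ext ?_ ?_)
  · funext β; simp
  · funext β
    simp only [Pi.single_apply]
    split_ifs <;> simp
  · simp [conj_pz]

theorem tOp_comp_fst (g : (ι → ℂ) → ℂ) (x : Pt ι) (hg : DifferentiableAt ℝ g x.1) :
    tOp (fun y : Pt ι => g y.1) x = 0 := by
  rw [tOp_eq]
  have : HasFDerivAt (fun y : Pt ι => g y.1)
      ((fderiv ℝ g x.1).comp (ContinuousLinearMap.fst ℝ (ι → ℂ) ℝ)) x :=
    hg.hasFDerivAt.comp x (ContinuousLinearMap.fst ℝ (ι → ℂ) ℝ).hasFDerivAt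
  rw [this.fderiv]
  simp

section Commutators

variable (hp : ContDiff ℝ ∞ p)
include hp

theorem contDiffOn_zOp {u : Pt ι → ℂ} {N : Set (Pt ι)} (hN : IsOpen N)
    (hu : ContDiffOn ℝ ∞ u N) (α : ι) : ContDiffOn ℝ ∞ (zOp p α u) N :=
  contDiffOn_act hN hu (fun _ => contDiffOn_const) (fun _ => contDiffOn_const)
    (contDiffOn_const.mul (contDiff_pz hp α).contDiffOn)

omit hp in
theorem contDiffOn_tOp {u : Pt ι → ℂ} {N : Set (Pt ι)} (hN : IsOpen N)
    (hu : ContDiffOn ℝ ∞ u N) : ContDiffOn ℝ ∞ (tOp u) N :=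
  contDiffOn_act hN hu (fun _ => contDiffOn_const) (fun _ => contDiffOn_const) contDiffOn_const

theorem differentiableAt_pz (α : ι) (x : Pt ι) : DifferentiableAt ℝ (fun y => pz p y α) x :=
  (contDiff_pz hp α).contDiffAt.differentiableAt (by simp)

theorem differentiableAt_pzbar (α : ι) (x : Pt ι) :
    DifferentiableAt ℝ (fun y => pzbar p y α) x :=
  (contDiff_pzbar hp α).contDiffAt.differentiableAt (by simp)

theorem tOp_ofReal (x : Pt ι) : tOp (fun y : Pt ι => (p y.1 : ℂ)) x = 0 := by
  refine tOp_comp_fst (fun z => (p z : ℂ)) x ?_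
  exact (Complex.ofRealCLM.contDiff.comp hp).contDiffAt.differentiableAt (by simp)

theorem act_bracket_frame {u : Pt ι → ℂ} {N : Set (Pt ι)} (hN : IsOpen N)
    (hu : ContDiffOn ℝ ∞ u N) {x : Pt ι} (hx : x ∈ N) {X Y : Pt ι → CTan ι}
    {a b a' b' : ι → ℂ} {c c' : Pt ι → ℂ} (hX : ∀ y, X y = (a, b, c y))
    (hY : ∀ y, Y y = (a', b', c' y)) (hc : DifferentiableAt ℝ c x)
    (hc' : DifferentiableAt ℝ c' x) :
    act (X x) (fun y => act (Y y) u y) x - act (Y x) (fun y => act (X y) u y) x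
      = (act (X x) c' x - act (Y x) c x) * tOp u x := by
  rw [act_bracket hN hu hx]
  · simp only [bracket]
    simp only [hX, hY, act_const, sub_zero]
    simp [act, tOp_eq]
  all_goals simp only [hX, hY]
  · exact fun _ => differentiableAt_const _
  · exact fun _ => differentiableAt_const _
  · exact hc
  · exact fun _ => differentiableAt_const _
  · exact fun _ => differentiableAt_const _
  · exact hc'

omit hp in
theorem act_eq_act_const_add (a b : ι → ℂ) (c : ℂ) (u : Pt ι → ℂ) (x : Pt ι) :
    act (a, b, c) u x = act (a, b, 0) u x + c * tOp u x := by
  simp [act, tOp_eq]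

theorem tOp_pz (α : ι) (x : Pt ι) : tOp (fun y => pz p y α) x = 0 := by
  have h := act_act_comm_const isOpen_univ (contDiff_ofReal_comp_fst hp).contDiffOn
    (Set.mem_univ x) (reeb x) (Pi.single α 1, 0, 0)
  have h1 : ∀ y, act (Pi.single α 1, 0, 0) (fun y : Pt ι => (p y.1 : ℂ)) y = pz p y α := by
    intro y
    simp [act, pz, Pi.single_apply]
  simp only [h1] at h
  rw [tOp, h]
  have h2 : ∀ y, act (reeb x) (fun y : Pt ι => (p y.1 : ℂ)) y = 0 := fun y => tOp_ofReal hp y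
  simp only [h2, act_const]

theorem tOp_pzbar (α : ι) (x : Pt ι) : tOp (fun y => pzbar p y α) x = 0 := by
  simp only [← conj_pz]
  rw [tOp_conj, tOp_pz hp, map_zero]

theorem zOp_ofReal (α : ι) (x : Pt ι) :
    zOp p α (fun y : Pt ι => (p y.1 : ℂ)) x = pz p x α := by
  rw [zOp, frameZ, act_eq_act_const_add, tOp_ofReal hp]
  simp [act, pz, Pi.single_apply]

theorem zbOp_ofReal (α : ι) (x : Pt ι) :
    zbOp p α (fun y : Pt ι => (p y.1 : ℂ)) x = pzbar p x α := by
  rw [← conj_pz, ← zOp_ofReal hp, ← zbOp_conj]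
  simp only [Complex.conj_ofReal]

omit hp in
theorem zOp_const_mul (α : ι) (c : ℂ) {u : Pt ι → ℂ} {x : Pt ι}
    (hu : DifferentiableAt ℝ u x) : zOp p α (fun y => c * u y) x = c * zOp p α u x :=
  act_const_mul _ c hu

theorem leviMatrix_apply (x : Pt ι) (α β : ι) :
    leviMatrix p x α β
      = zOp p α (fun y => pzbar p y β) x + zbOp p β (fun y => pz p y α) x := by
  have h1 : ∀ y, theta p y (frameZbar p β x)
      = -Complex.I * pzbar p x β + Complex.I * pzbar p y β := by
    intro y
    simp [theta, frameZbar_eq, Pi.single_apply]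
  have h2 : ∀ y, theta p y (frameZ p α x)
      = Complex.I * pz p x α + (-Complex.I) * pz p y α := by
    intro y
    simp [theta, frameZ, Pi.single_apply]
    ring
  simp only [leviMatrix, Matrix.of_apply, levi, dtheta, h1, h2]
  rw [act_add _ (differentiableAt_const _) ((differentiableAt_pzbar hp β x).const_mul _),
    act_add _ (differentiableAt_const _) ((differentiableAt_pz hp α x).const_mul _), act_const,
    act_const, act_const_mul _ _ (differentiableAt_pzbar hp β x),
    act_const_mul _ _ (differentiableAt_pz hp α x), zOp, zbOp]
  linear_combination (-act (frameZ p α x) (fun y => pzbar p y β) x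
    - act (frameZbar p β x) (fun y => pz p y α) x) * Complex.I_sq

/-- `[Z_α, Z_β̄] = -i h_{αβ̄} T`. -/
theorem zOp_zbOp_comm {u : Pt ι → ℂ} {N : Set (Pt ι)} (hN : IsOpen N)
    (hu : ContDiffOn ℝ ∞ u N) {x : Pt ι} (hx : x ∈ N) (α β : ι) :
    zOp p α (zbOp p β u) x - zbOp p β (zOp p α u) x
      = -Complex.I * leviMatrix p x α β * tOp u x := by
  have h := act_bracket_frame hp hN hu hx (X := frameZ p α) (Y := frameZbar p β)
    (fun y => rfl) (frameZbar_eq β) ((differentiableAt_pz hp α x).const_mul _)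
    ((differentiableAt_pzbar hp β x).const_mul _)
  refine h.trans ?_
  rw [leviMatrix_apply hp, act_const_mul _ _ (differentiableAt_pzbar hp β x),
    act_const_mul _ _ (differentiableAt_pz hp α x), zOp, zbOp]
  ring

theorem tOp_zOp {u : Pt ι → ℂ} {N : Set (Pt ι)} (hN : IsOpen N)
    (hu : ContDiffOn ℝ ∞ u N) {x : Pt ι} (hx : x ∈ N) (α : ι) :
    tOp (zOp p α u) x = zOp p α (tOp u) x := by
  have h := act_bracket_frame hp hN hu hx (X := reeb) (Y := frameZ p α)
    (fun y => rfl) (fun y => rfl) (differentiableAt_const _)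
    ((differentiableAt_pz hp α x).const_mul _)
  have h' := tOp_pz hp α x
  rw [act_const_mul _ _ (differentiableAt_pz hp α x), act_const] at h
  rw [tOp] at h'
  rw [h'] at h
  exact sub_eq_zero.1 (h.trans (by ring))

theorem tOp_zbOp {u : Pt ι → ℂ} {N : Set (Pt ι)} (hN : IsOpen N)
    (hu : ContDiffOn ℝ ∞ u N) {x : Pt ι} (hx : x ∈ N) (α : ι) :
    tOp (zbOp p α u) x = zbOp p α (tOp u) x := by
  have h := act_bracket_frame hp hN hu hx (X := reeb) (Y := frameZbar p α)
    (fun y => rfl) (frameZbar_eq α) (differentiableAt_const _)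
    ((differentiableAt_pzbar hp α x).const_mul _)
  have h' := tOp_pzbar hp α x
  rw [act_const_mul _ _ (differentiableAt_pzbar hp α x), act_const] at h
  rw [tOp] at h'
  rw [h'] at h
  exact sub_eq_zero.1 (h.trans (by ring))

theorem zOp_pz_symm (α β : ι) (x : Pt ι) :
    zOp p α (fun y => pz p y β) x = zOp p β (fun y => pz p y α) x := by
  have h := act_act_comm_const isOpen_univ (contDiff_ofReal_comp_fst hp).contDiffOn
    (Set.mem_univ x) (Pi.single α 1, 0, 0) (Pi.single β 1, 0, 0)
  have h1 : ∀ β y, act (Pi.single β 1, 0, 0) (fun y : Pt ι => (p y.1 : ℂ)) y = pz p y β := by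
    intro β y
    simp [act, pz, Pi.single_apply]
  simp only [h1] at h
  have h2 := act_eq_act_const_add (Pi.single α 1) 0 (Complex.I * pz p x α)
    (fun y => pz p y β) x
  have h3 := act_eq_act_const_add (Pi.single β 1) 0 (Complex.I * pz p x β)
    (fun y => pz p y α) x
  rw [tOp_pz hp, mul_zero, add_zero] at h2 h3
  exact h2.trans (h.trans h3.symm)

theorem zOp_zOp_comm {u : Pt ι → ℂ} {N : Set (Pt ι)} (hN : IsOpen N)
    (hu : ContDiffOn ℝ ∞ u N) {x : Pt ι} (hx : x ∈ N) (α β : ι) :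
    zOp p α (zOp p β u) x = zOp p β (zOp p α u) x := by
  have h := act_bracket_frame hp hN hu hx (X := frameZ p α) (Y := frameZ p β)
    (fun y => rfl) (fun y => rfl) ((differentiableAt_pz hp α x).const_mul _)
    ((differentiableAt_pz hp β x).const_mul _)
  rw [act_const_mul _ _ (differentiableAt_pz hp β x),
    act_const_mul _ _ (differentiableAt_pz hp α x)] at h
  have h' := zOp_pz_symm hp α β x
  rw [zOp, zOp] at h'
  rw [h', sub_self, zero_mul] at h
  exact sub_eq_zero.1 h

theorem leviMatrix_eq_two_mul (x : Pt ι) (α β : ι) :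
    leviMatrix p x α β = 2 * zOp p α (fun y => pzbar p y β) x := by
  have h := zOp_zbOp_comm hp isOpen_univ (contDiff_ofReal_comp_fst hp).contDiffOn
    (Set.mem_univ x) α β
  have h1 : zbOp p β (fun y : Pt ι => (p y.1 : ℂ)) = fun y => pzbar p y β :=
    funext fun y => zbOp_ofReal hp β y
  have h2 : zOp p α (fun y : Pt ι => (p y.1 : ℂ)) = fun y => pz p y α :=
    funext fun y => zOp_ofReal hp α y
  rw [h1, h2, tOp_ofReal hp, mul_zero] at h
  rw [leviMatrix_apply hp]
  linear_combination -h

theorem conj_leviMatrix (x : Pt ι) (α β : ι) :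
    conj (leviMatrix p x α β) = leviMatrix p x β α := by
  rw [leviMatrix_apply hp, leviMatrix_apply hp, map_add, ← zbOp_conj, ← zOp_conj]
  simp only [conj_pz, conj_pzbar]
  ring

theorem contDiff_leviMatrix (α β : ι) : ContDiff ℝ ∞ (fun y => leviMatrix p y α β) := by
  simp only [leviMatrix_eq_two_mul hp]
  exact contDiff_const.mul (contDiffOn_univ.1
    (contDiffOn_zOp hp isOpen_univ (contDiff_pzbar hp β).contDiffOn α))

theorem zOp_leviMatrix_symm (x : Pt ι) (l α β : ι) :
    zOp p l (fun y => leviMatrix p y α β) x = zOp p α (fun y => leviMatrix p y l β) x := by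
  have hs := (contDiff_pzbar hp β).contDiffOn (s := Set.univ)
  have hd : ∀ γ, DifferentiableAt ℝ (fun y => zOp p γ (fun y => pzbar p y β) y) x := fun γ =>
    differentiableAt_of_contDiffOn isOpen_univ (contDiffOn_zOp hp isOpen_univ hs γ)
      (Set.mem_univ x)
  simp only [leviMatrix_eq_two_mul hp]
  rw [zOp_const_mul _ _ (hd _), zOp_const_mul _ _ (hd _)]
  congr 1
  exact zOp_zOp_comm hp isOpen_univ hs (Set.mem_univ x) l α

end Commutators

/-! ### Connection and curvature in the frame `Z_α` -/

/-- The connection matrix `(Γ_l)^σ_α`: `∇_{Z_l} Z_α = ∑ (Γ_l)^σ_α Z_σ`. -/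
noncomputable def christoffel (p : (ι → ℂ) → ℝ) (l : ι) (x : Pt ι) : Matrix ι ι ℂ :=
  Matrix.of fun σ α => ∑ β, leviInv p x σ β * zOp p l (fun y => leviMatrix p y α β) x

/-- The matrix of the curvature endomorphism `R(Z_l, Z_μ̄)` of `T^{1,0}` in the frame `Z_α`. -/
noncomputable def curvMatrix (p : (ι → ℂ) → ℝ) (l μ : ι) (x : Pt ι) : Matrix ι ι ℂ :=
  Matrix.of fun σ α => -zbOp p μ (fun y => christoffel p l y σ α) x

theorem projHol_frameZ (α : ι) : projHol p (frameZ p α) = frameZ p α := by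
  funext x
  simp only [projHol]
  rw [Finset.sum_eq_single α]
  · simp [frameZ]
  · intro b _ hb
    simp [frameZ, hb]
  · simp

theorem projHol_of_fst_eq_zero {X : Pt ι → CTan ι} {x : Pt ι} (h : (X x).1 = 0) :
    projHol p X x = 0 := by
  simp [projHol, h]

theorem projAnti_of_eq_zero {X : Pt ι → CTan ι} {x : Pt ι} (h : (X x).2.1 = 0) :
    projAnti p X x = 0 := by
  simp [projAnti, h]

theorem projAnti_frameZbar (α : ι) : projAnti p (frameZbar p α) = frameZbar p α := by
  funext x
  simp only [projAnti]
  rw [Finset.sum_eq_single α]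
  · simp [frameZbar_eq]
  · intro b _ hb
    simp [frameZbar_eq, hb]
  · simp

theorem theta_frameZ (α : ι) (x : Pt ι) : theta p x (frameZ p α x) = 0 := by
  simp [theta, frameZ, Pi.single_apply]

theorem theta_frameZbar (α : ι) (x : Pt ι) : theta p x (frameZbar p α x) = 0 := by
  simp [theta, frameZbar_eq, Pi.single_apply]

theorem levi_zero_left (x : Pt ι) (w : CTan ι) : levi p x 0 w = 0 := by
  simp [levi, dtheta, act_zero_vec, theta, act_const]

theorem levi_zero_right (x : Pt ι) (v : CTan ι) : levi p x v 0 = 0 := by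
  simp [levi, dtheta, act_zero_vec, theta, act_const]

theorem bracket_fst_of_const {X Y : Pt ι → CTan ι} (x : Pt ι) {a b : ι → ℂ}
    (hX : ∀ y, (X y).1 = a) (hY : ∀ y, (Y y).1 = b) : (bracket X Y x).1 = 0 := by
  funext α
  simp [bracket, hX, hY, act_const]

theorem bracket_snd_of_const {X Y : Pt ι → CTan ι} (x : Pt ι) {a b : ι → ℂ}
    (hX : ∀ y, (X y).2.1 = a) (hY : ∀ y, (Y y).2.1 = b) : (bracket X Y x).2.1 = 0 := by
  funext α
  simp [bracket, hX, hY, act_const]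

theorem webster_frameZ_frameZ (l α : ι) (x : Pt ι) :
    webster p (frameZ p l) (frameZ p α) x
      = ∑ σ, christoffel p l x σ α • frameZ p σ x := by
  rw [webster, projHol_frameZ, theta_frameZ, zero_smul, add_zero]
  have h1 : ∀ y, projAnti p (frameZ p l) y = 0 := fun y => projAnti_of_eq_zero rfl
  rw [projHol_of_fst_eq_zero (X := bracket (projAnti p (frameZ p l)) (frameZ p α)), add_zero]
  · refine Finset.sum_congr rfl fun σ _ => ?_
    congr 1
    simp only [christoffel, Matrix.of_apply]
    refine Finset.sum_congr rfl fun β _ => ?_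
    rw [projAnti_of_eq_zero (X := bracket (frameZ p l) (frameZbar p β)), levi_zero_right,
      sub_zero]
    · rfl
    · exact bracket_snd_of_const x (fun y => rfl) (b := Pi.single β 1)
        fun y => by rw [frameZbar_eq]
  · exact bracket_fst_of_const x (a := 0) (fun y => by rw [h1]; rfl) (fun y => rfl)

theorem webster_frameZbar (μ : ι) (V : Pt ι → CTan ι) (x : Pt ι) :
    webster p (frameZbar p μ) V x = projHol p (bracket (frameZbar p μ) V) x := by
  have h1 : projHol p (frameZbar p μ) = fun _ => 0 :=
    funext fun y => projHol_of_fst_eq_zero (by rw [frameZbar_eq])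
  rw [webster, h1, theta_frameZbar, zero_smul, add_zero, projAnti_frameZbar]
  rw [Finset.sum_eq_zero, zero_add]
  intro σ _
  rw [Finset.sum_eq_zero, zero_smul]
  intro β _
  rw [projAnti_of_eq_zero (X := bracket (fun _ => 0) (frameZbar p β)), levi_zero_right,
    act_zero_vec, sub_zero, mul_zero]
  exact bracket_snd_of_const x (a := 0) (fun y => rfl) (b := Pi.single β 1)
    fun y => by rw [frameZbar_eq]

theorem webster_frameZbar_frameZ (μ α : ι) (x : Pt ι) :
    webster p (frameZbar p μ) (frameZ p α) x = 0 := by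
  rw [webster_frameZbar]
  exact projHol_of_fst_eq_zero (bracket_fst_of_const x (a := 0)
    (fun y => by rw [frameZbar_eq]) (fun y => rfl))

theorem webster_zero_right (l : ι) (x : Pt ι) :
    webster p (frameZ p l) (fun _ => 0) x = 0 := by
  have h1 : ∀ y, projAnti p (frameZ p l) y = 0 := fun y => projAnti_of_eq_zero rfl
  rw [webster, projHol_frameZ, theta_frameZ, zero_smul, add_zero]
  rw [projHol_of_fst_eq_zero (X := bracket (projAnti p (frameZ p l)) (fun _ => 0)), add_zero]
  · refine Finset.sum_eq_zero fun σ _ => ?_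
    rw [Finset.sum_eq_zero, zero_smul]
    intro β _
    simp only [levi_zero_left, act_const, sub_zero, mul_zero]
  · exact bracket_fst_of_const x (a := 0) (fun y => by rw [h1]; rfl) (b := 0) (fun y => rfl)

theorem webster_bracket (l μ α : ι) (x : Pt ι) :
    webster p (bracket (frameZ p l) (frameZbar p μ)) (frameZ p α) x = 0 := by
  set X := bracket (frameZ p l) (frameZbar p μ)
  have hX1 : ∀ y, (X y).1 = 0 := fun y =>
    bracket_fst_of_const y (fun _ => rfl) (b := 0) (fun _ => by rw [frameZbar_eq])
  have hX2 : ∀ y, (X y).2.1 = 0 := fun y =>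
    bracket_snd_of_const y (fun _ => rfl) (b := Pi.single μ 1) (fun _ => by rw [frameZbar_eq])
  have h1 : projHol p X = fun _ => 0 := funext fun y => projHol_of_fst_eq_zero (hX1 y)
  have h2 : projAnti p X = fun _ => 0 := funext fun y => projAnti_of_eq_zero (hX2 y)
  rw [webster, h1, h2, projHol_of_fst_eq_zero (X := bracket (fun _ => 0) (frameZ p α)),
    projHol_of_fst_eq_zero (X := bracket reeb (frameZ p α)), smul_zero, add_zero, add_zero]
  · refine Finset.sum_eq_zero fun σ _ => ?_
    rw [Finset.sum_eq_zero, zero_smul]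
    intro β _
    rw [projAnti_of_eq_zero (X := bracket (fun _ => 0) (frameZbar p β)), levi_zero_right,
      act_zero_vec, sub_zero, mul_zero]
    exact bracket_snd_of_const x (a := 0) (fun y => rfl) (b := Pi.single β 1)
      fun y => by rw [frameZbar_eq]
  · exact bracket_fst_of_const x (fun y => rfl) (fun y => rfl)
  · exact bracket_fst_of_const x (a := 0) (fun y => rfl) (fun y => rfl)

theorem sum_smul_frameZ_fst (c : ι → ℂ) (x : Pt ι) :
    (∑ σ, c σ • frameZ p σ x).1 = c := by
  funext α
  simp [Prod.fst_sum, frameZ, Pi.single_apply]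

theorem curvOp_frame (l μ α : ι) (x : Pt ι) :
    curvOp p (frameZ p l) (frameZbar p μ) (frameZ p α) x
      = ∑ σ, curvMatrix p l μ x σ α • frameZ p σ x := by
  have h1 : webster p (frameZbar p μ) (frameZ p α) = fun _ => 0 :=
    funext fun y => webster_frameZbar_frameZ μ α y
  have h2 : webster p (frameZ p l) (frameZ p α)
      = fun y => ∑ σ, christoffel p l y σ α • frameZ p σ y :=
    funext fun y => webster_frameZ_frameZ l α y
  rw [curvOp, h1, webster_zero_right, webster_bracket, h2, webster_frameZbar, zero_sub, sub_zero,
    projHol, ← Finset.sum_neg_distrib]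
  refine Finset.sum_congr rfl fun σ _ => ?_
  rw [← neg_smul]
  congr 2
  simp only [bracket, sum_smul_frameZ_fst]
  simp only [frameZbar_eq, Pi.zero_apply, act_const, sub_zero]
  rw [zbOp, frameZbar_eq]

theorem levi_sum_frameZ (hp : ContDiff ℝ ∞ p) (c : ι → ℂ) (x : Pt ι) (β : ι) :
    levi p x (∑ σ, c σ • frameZ p σ x) (frameZbar p β x) = ∑ σ, c σ * leviMatrix p x σ β := by
  have hθ : ∀ y (v : ι → CTan ι), theta p y (∑ σ, c σ • v σ) = ∑ σ, c σ * theta p y (v σ) := by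
    intro y v
    simp only [theta, Prod.fst_sum, Prod.snd_sum, Finset.sum_apply, Prod.smul_fst, Prod.smul_snd,
      Pi.smul_apply, smul_eq_mul, mul_sub, Finset.mul_sum, Finset.sum_sub_distrib]
    rw [Finset.sum_comm (f := fun i j => Complex.I * (pz p y i * (c j * (v j).1 i))),
      Finset.sum_comm (f := fun i j => Complex.I * (pzbar p y i * (c j * (v j).2.1 i)))]
    congr 1
    congr 1
    all_goals
      refine Finset.sum_congr rfl fun i _ => Finset.sum_congr rfl fun j _ => ?_
      ring
  have hd : ∀ v : CTan ι, DifferentiableAt ℝ (fun y => theta p y v) x := by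
    intro v
    simp only [theta]
    exact (differentiableAt_const _).sub ((DifferentiableAt.fun_sum fun α _ =>
      ((differentiableAt_pz hp α x).mul_const _).sub
        ((differentiableAt_pzbar hp α x).mul_const _)).const_mul _)
  simp only [leviMatrix, Matrix.of_apply, levi, dtheta, act_sum_vec, act_smul_vec, hθ]
  rw [act_sum _ _ (fun σ _ => (hd _).const_mul _)]
  simp only [act_const_mul _ _ (hd _), mul_sub, Finset.mul_sum, Finset.sum_sub_distrib]
  congr 1 <;> exact Finset.sum_congr rfl fun σ _ => by ring

/-- `∑_β h^{lβ̄} h_{σβ̄} = δ`. -/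
theorem sum_leviInv_mul {x : Pt ι} (hdet : (leviMatrix p x).det ≠ 0) (l σ : ι) :
    ∑ β, leviInv p x l β * leviMatrix p x σ β = if l = σ then 1 else 0 := by
  have h : leviInv p x * (leviMatrix p x).transpose = 1 :=
    Matrix.nonsing_inv_mul _ (by rw [Matrix.det_transpose]; exact isUnit_iff_ne_zero.2 hdet)
  have := congrFun (congrFun h l) σ
  rw [Matrix.mul_apply, Matrix.one_apply] at this
  simpa using this

theorem sum_leviInv_mul' {x : Pt ι} (hdet : (leviMatrix p x).det ≠ 0) (α β : ι) :
    ∑ σ, leviMatrix p x σ α * leviInv p x σ β = if α = β then 1 else 0 := by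
  have h : (leviMatrix p x).transpose * leviInv p x = 1 :=
    Matrix.mul_nonsing_inv _ (by rw [Matrix.det_transpose]; exact isUnit_iff_ne_zero.2 hdet)
  have := congrFun (congrFun h α) β
  rw [Matrix.mul_apply, Matrix.one_apply] at this
  simpa using this

theorem ricciComp_eq (hp : ContDiff ℝ ∞ p) {x : Pt ι} (hdet : (leviMatrix p x).det ≠ 0)
    (α μ : ι) : ricciComp p x α μ = ∑ l, curvMatrix p l μ x l α := by
  refine Finset.sum_congr rfl fun l _ => ?_
  simp only [curvComp, curvOp_frame, levi_sum_frameZ hp, Finset.mul_sum]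
  rw [Finset.sum_comm]
  calc _ = ∑ σ, curvMatrix p l μ x σ α * ∑ β, leviInv p x l β * leviMatrix p x σ β := by
        refine Finset.sum_congr rfl fun σ _ => ?_
        rw [Finset.mul_sum]
        exact Finset.sum_congr rfl fun β _ => by ring
    _ = _ := by simp [sum_leviInv_mul hdet]

/-- Metric compatibility: `Z_l h_{αβ̄} = ∑ (Γ_l)^σ_α h_{σβ̄}`. -/
theorem zOp_leviMatrix {x : Pt ι} (hdet : (leviMatrix p x).det ≠ 0) (l α β : ι) :
    zOp p l (fun y => leviMatrix p y α β) x
      = ∑ σ, christoffel p l x σ α * leviMatrix p x σ β := by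
  simp only [christoffel, Matrix.of_apply, Finset.sum_mul]
  rw [Finset.sum_comm]
  calc _ = ∑ γ, zOp p l (fun y => leviMatrix p y α γ) x
        * ∑ σ, leviMatrix p x σ β * leviInv p x σ γ := by simp [sum_leviInv_mul' hdet]
    _ = _ := by
        refine Finset.sum_congr rfl fun σ _ => ?_
        rw [Finset.mul_sum]
        exact Finset.sum_congr rfl fun β _ => by ring

theorem christoffel_symm (hp : ContDiff ℝ ∞ p) (l α σ : ι) (x : Pt ι) :
    christoffel p l x σ α = christoffel p α x σ l := by
  simp only [christoffel, Matrix.of_apply, zOp_leviMatrix_symm hp x l α]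

theorem contDiffOn_leviInv (hp : ContDiff ℝ ∞ p) {N : Set (Pt ι)}
    (hdet : ∀ x ∈ N, (leviMatrix p x).det ≠ 0) (α β : ι) :
    ContDiffOn ℝ ∞ (fun y => leviInv p y α β) N := by
  have hD : ∀ A : Pt ι → Matrix ι ι ℂ, (∀ i j, ContDiff ℝ ∞ fun y => A y i j) →
      ContDiff ℝ ∞ fun y => (A y).det := by
    intro A hA
    simp only [Matrix.det_apply]
    refine ContDiff.sum fun σ _ => ?_
    simp only [Units.smul_def, zsmul_eq_mul]
    exact contDiff_const.mul (contDiff_prod fun i _ => hA _ _)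
  have ht : ∀ i j, ContDiff ℝ ∞ fun y => (leviMatrix p y).transpose i j :=
    fun i j => contDiff_leviMatrix hp j i
  have hadj : ContDiff ℝ ∞ fun y => (leviMatrix p y).transpose.adjugate α β := by
    simp only [Matrix.adjugate_apply]
    refine hD _ fun i j => ?_
    simp only [Matrix.updateRow_apply]
    split_ifs
    · exact contDiff_const
    · exact ht i j
  have : ∀ y, leviInv p y α β = ((leviMatrix p y).transpose.det)⁻¹
      * (leviMatrix p y).transpose.adjugate α β := by
    intro y
    rw [leviInv, Matrix.inv_def, Ring.inverse_eq_inv']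
    rfl
  simp only [this]
  refine ((hD _ ht).contDiffOn.inv ?_).mul hadj.contDiffOn
  intro x hx
  rw [Matrix.det_transpose]
  exact hdet x hx

theorem contDiffOn_christoffel (hp : ContDiff ℝ ∞ p) {N : Set (Pt ι)} (hN : IsOpen N)
    (hdet : ∀ x ∈ N, (leviMatrix p x).det ≠ 0) (l σ α : ι) :
    ContDiffOn ℝ ∞ (fun y => christoffel p l y σ α) N := by
  simp only [christoffel, Matrix.of_apply]
  exact ContDiffOn.sum fun β _ => (contDiffOn_leviInv hp hdet σ β).mul
    (contDiffOn_zOp hp hN (contDiff_leviMatrix hp α β).contDiffOn l)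

theorem act_conj_coord (v : CTan ι) (x : Pt ι) (α : ι) :
    act v (fun y => conj (y.1 α)) x = v.2.1 α := by
  have hf : ∀ e, fderiv ℝ (fun y : Pt ι => conj (y.1 α)) x e = conj (e.1 α) := by
    intro e
    rw [fderiv_conj_apply]
    exact congrArg (fun L => conj (L e)) (((ContinuousLinearMap.proj (R := ℝ)
      (φ := fun _ : ι => ℂ) α).comp (ContinuousLinearMap.fst ℝ (ι → ℂ) ℝ)).fderiv (x := x))
  simp only [act, dz, dzbar, hf]
  rw [Finset.sum_eq_single α]
  · have : (1 : ℂ) + Complex.I * Complex.I = 0 := by rw [Complex.I_mul_I]; ring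
    simp
  · intro b _ hb
    simp [hb.symm]
  · simp

/-- `T^{1,0}` is spanned by the frame `Z_α`. -/
theorem mem_holTangent_iff (hp : ContDiff ℝ ∞ p) {x : Pt ι} {v : CTan ι} :
    v ∈ holTangent p x ↔ v = ∑ α, v.1 α • frameZ p α x := by
  have h0 := act_conj_coord v x
  have hP := contDiff_ofReal_comp_fst hp
  have hPd : DifferentiableAt ℝ (fun y : Pt ι => (p y.1 : ℂ)) x :=
    hP.contDiffAt.differentiableAt (by simp)
  have ht : HasFDerivAt (fun y : Pt ι => (y.2 : ℂ))
      (Complex.ofRealCLM.comp (ContinuousLinearMap.snd ℝ (ι → ℂ) ℝ)) x :=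
    (Complex.ofRealCLM.comp (ContinuousLinearMap.snd ℝ (ι → ℂ) ℝ)).hasFDerivAt
  have h1 : act v (fun y => conj (zLast p y)) x
      = v.2.2 - Complex.I * ∑ α, (v.1 α * pz p x α + v.2.1 α * pzbar p x α) := by
    have e : (fun y : Pt ι => conj (zLast p y))
        = fun y => (y.2 : ℂ) + (-Complex.I) * (p y.1 : ℂ) := by
      funext y
      simp [zLast]
    rw [e, act_add _ ht.differentiableAt (hPd.const_mul _), act_const_mul _ _ hPd]
    have e1 : act v (fun y : Pt ι => (y.2 : ℂ)) x = v.2.2 := by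
      simp [act, dz, dzbar, ht.fderiv]
    have e2 : act v (fun y : Pt ι => (p y.1 : ℂ)) x
        = ∑ α, (v.1 α * pz p x α + v.2.1 α * pzbar p x α) := by
      have := tOp_ofReal hp x
      rw [tOp_eq] at this
      simp only [act, this, mul_zero, add_zero]
      rfl
    rw [e1, e2]
    ring
  have h2 : ∑ α, v.1 α • frameZ p α x
      = (v.1, 0, Complex.I * ∑ α, v.1 α * pz p x α) := by
    refine Prod.ext (sum_smul_frameZ_fst _ _) (Prod.ext ?_ ?_)
    · simp [Prod.snd_sum, Prod.fst_sum, frameZ]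
    · simp only [Prod.snd_sum, Prod.smul_snd, frameZ, smul_eq_mul, Finset.mul_sum]
      exact Finset.sum_congr rfl fun α _ => by ring
  rw [h2]
  change ((∀ α, act v (fun y => conj (y.1 α)) x = 0) ∧ act v (fun y => conj (zLast p y)) x = 0)
    ↔ _
  simp only [h0, h1]
  constructor
  · rintro ⟨a, b⟩
    refine Prod.ext rfl (Prod.ext (funext a) ?_)
    simp only [a, zero_mul, add_zero] at b
    exact sub_eq_zero.1 b
  · intro h
    have a : ∀ α, v.2.1 α = 0 := fun α => by rw [h]; rfl
    refine ⟨a, ?_⟩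
    simp only [a, zero_mul, add_zero]
    have : v.2.2 = Complex.I * ∑ α, v.1 α * pz p x α := congrArg (fun w => w.2.2) h
    rw [this, sub_self]

theorem frameZ_mem_holTangent (hp : ContDiff ℝ ∞ p) (α : ι) (x : Pt ι) :
    frameZ p α x ∈ holTangent p x := by
  rw [mem_holTangent_iff hp]
  rw [Finset.sum_eq_single α]
  · simp [frameZ]
  · intro b _ hb
    simp [frameZ, hb]
  · simp

end Frame

/-! ### The differential of a CR map in the frame `Z_α` -/

section CRMap

variable {ι : Type} [Fintype ι] [DecidableEq ι] {p : (ι → ℂ) → ℝ}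

theorem act_sum_mul (w : CTan ι) {κ : Type*} (s : Finset κ) {a b : κ → Pt ι → ℂ} {x : Pt ι}
    (ha : ∀ i, DifferentiableAt ℝ (a i) x) (hb : ∀ i, DifferentiableAt ℝ (b i) x) :
    act w (fun y => ∑ i ∈ s, a i y * b i y) x
      = ∑ i ∈ s, (act w (a i) x * b i x + a i x * act w (b i) x) := by
  rw [act_sum (u := fun i y => a i y * b i y) s w (fun i _ => (ha i).mul (hb i))]
  exact Finset.sum_congr rfl fun i _ => act_mul w (ha i) (hb i)

/-- The matrix `J^γ_α = Z_α F^γ` of `f_*` on `T^{1,0}`, where `F^γ = z^γ ∘ f`. -/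
noncomputable def jac (p : (ι → ℂ) → ℝ) (f : Pt ι → Pt ι) (γ α : ι) (x : Pt ι) : ℂ :=
  zOp p α (fun y => (f y).1 γ) x

/-- The `T^{1,0}` components `a^γ = T F^γ` of `f_* T`. -/
noncomputable def drift (f : Pt ι → Pt ι) (γ : ι) (x : Pt ι) : ℂ :=
  tOp (fun y => (f y).1 γ) x

/-- The factor `lam` as a complex-valued function. -/
abbrev clam (lam : Pt ι → ℝ) (y : Pt ι) : ℂ := (lam y : ℂ)

/-- `u_ε = Z_ε log lam`. -/
noncomputable def logGrad (p : (ι → ℂ) → ℝ) (lam : Pt ι → ℝ) (ε : ι) (y : Pt ι) : ℂ :=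
  (clam lam y)⁻¹ * zOp p ε (clam lam) y

variable {f : Pt ι → Pt ι} {N N' : Set (Pt ι)} {lam : Pt ι → ℝ}

namespace IsCRDiffeo

variable (hp : ContDiff ℝ ∞ p) (hN : IsOpen N) (hf : IsCRDiffeo p f N N' lam)

section First
include hf

theorem contDiffOn_coord (γ : ι) : ContDiffOn ℝ ∞ (fun y => (f y).1 γ) N :=
  ((ContinuousLinearMap.proj (R := ℝ) (φ := fun _ : ι => ℂ) γ).comp
    (ContinuousLinearMap.fst ℝ (ι → ℂ) ℝ)).contDiff.comp_contDiffOn hf.smooth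

theorem contDiffOn_time : ContDiffOn ℝ ∞ (fun y => ((f y).2 : ℂ)) N :=
  (Complex.ofRealCLM.comp (ContinuousLinearMap.snd ℝ (ι → ℂ) ℝ)).contDiff.comp_contDiffOn
    hf.smooth

theorem contDiffOn_comp {u : Pt ι → ℂ}
    (hu : ContDiffOn ℝ ∞ u N') : ContDiffOn ℝ ∞ (fun y => u (f y)) N :=
  hu.comp hf.smooth hf.mapsTo

include hN

theorem differentiableAt {x : Pt ι} (hx : x ∈ N) : DifferentiableAt ℝ f x :=
  (hf.smooth.contDiffAt (hN.mem_nhds hx)).differentiableAt (by simp)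

theorem contDiffOn_drift (γ : ι) : ContDiffOn ℝ ∞ (drift f γ) N :=
  contDiffOn_tOp hN (hf.contDiffOn_coord γ)

include hp

theorem contDiffOn_jac (γ α : ι) : ContDiffOn ℝ ∞ (jac p f γ α) N :=
  contDiffOn_zOp hp hN (hf.contDiffOn_coord γ) α

omit hN hp in
theorem clam_ne_zero {x : Pt ι} (hx : x ∈ N) : clam lam x ≠ 0 :=
  Complex.ofReal_ne_zero.2 (hf.factor_pos x hx).ne'

omit hN in
theorem pushforward_frameZ {x : Pt ι} (hx : x ∈ N) (α : ι) :
    pushforward f x (frameZ p α x) = ∑ γ, jac p f γ α x • frameZ p γ (f x) :=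
  (mem_holTangent_iff hp).1 (hf.map_hol x hx _ (frameZ_mem_holTangent hp α x))

omit hN in
theorem pushforward_frameZbar {x : Pt ι} (hx : x ∈ N) (α : ι) :
    pushforward f x (frameZbar p α x) = ∑ γ, conj (jac p f γ α x) • frameZbar p γ (f x) := by
  rw [frameZbar, pushforward_conjVec, hf.pushforward_frameZ hp hx]
  refine Prod.ext ?_ (Prod.ext ?_ ?_)
  · funext β
    simp [conjVec, frameZbar, Prod.fst_sum, Prod.snd_sum]
  · funext β
    simp [conjVec, frameZbar, Prod.fst_sum, Prod.snd_sum]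
  · simp [conjVec, frameZbar, Prod.snd_sum]

omit hN in
/-- The components `z^γ ∘ f` are CR functions. -/
theorem zbOp_coord {x : Pt ι} (hx : x ∈ N) (β γ : ι) :
    zbOp p β (fun y => (f y).1 γ) x = 0 := by
  have h := congrArg (fun v : CTan ι => v.1 γ) (hf.pushforward_frameZbar hp hx β)
  refine Eq.trans ?_ (h.trans ?_)
  · rfl
  · simp [Prod.fst_sum, frameZbar_eq]

omit hN in
theorem zOp_time {x : Pt ι} (hx : x ∈ N) (α : ι) :
    zOp p α (fun y => ((f y).2 : ℂ)) x
      = Complex.I * ∑ γ, pz p (f x) γ * jac p f γ α x := by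
  have h := congrArg (fun v : CTan ι => v.2.2) (hf.pushforward_frameZ hp hx α)
  refine Eq.trans ?_ (h.trans ?_)
  · rfl
  · simp only [Prod.snd_sum, Prod.smul_snd, frameZ, smul_eq_mul, Finset.mul_sum]
    exact Finset.sum_congr rfl fun γ _ => by ring

omit hN in
theorem zbOp_time {x : Pt ι} (hx : x ∈ N) (α : ι) :
    zbOp p α (fun y => ((f y).2 : ℂ)) x
      = -Complex.I * ∑ γ, pzbar p (f x) γ * conj (jac p f γ α x) := by
  have h := zbOp_conj p α (fun y => ((f y).2 : ℂ)) x
  rw [hf.zOp_time hp hx] at h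
  simp only [Complex.conj_ofReal, map_mul, Complex.conj_I, map_sum, conj_pz] at h
  exact h

omit hN hp in
theorem tOp_time {x : Pt ι} (hx : x ∈ N) :
    tOp (fun y => ((f y).2 : ℂ)) x = clam lam x
      + Complex.I * ∑ γ, (pz p (f x) γ * drift f γ x - pzbar p (f x) γ * conj (drift f γ x)) := by
  have h := hf.pullback_theta x hx (reeb x)
  have h1 : theta p x (reeb x) = 1 := by simp [theta, reeb]
  rw [h1, mul_one] at h
  rw [clam, ← h]
  simp only [theta, pushforward]
  have h2 : ∀ γ, act (reeb x) (fun y => conj ((f y).1 γ)) x = conj (drift f γ x) :=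
    fun γ => tOp_conj _ _
  simp only [h2]
  simp only [drift, tOp]
  ring

theorem contDiffOn_clam : ContDiffOn ℝ ∞ (clam lam) N := by
  have h : ContDiffOn ℝ ∞ (fun x => tOp (fun y => ((f y).2 : ℂ)) x
      - Complex.I * ∑ γ, (pz p (f x) γ * drift f γ x
        - pzbar p (f x) γ * conj (drift f γ x))) N := by
    refine (contDiffOn_tOp hN hf.contDiffOn_time).sub (contDiffOn_const.mul
      (ContDiffOn.sum fun γ _ => ?_))
    exact ((hf.contDiffOn_comp (contDiff_pz hp γ).contDiffOn).mul (hf.contDiffOn_drift hN γ)).sub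
      ((hf.contDiffOn_comp (contDiff_pzbar hp γ).contDiffOn).mul
        (contDiffOn_conj (hf.contDiffOn_drift hN γ)))
  refine h.congr fun x hx => ?_
  rw [hf.tOp_time hx]
  ring

/-- Chain rule for `Z_ε`. -/
theorem zOp_comp {u : Pt ι → ℂ} {x : Pt ι} (hx : x ∈ N) (hu : DifferentiableAt ℝ u (f x))
    (ε : ι) : zOp p ε (fun y => u (f y)) x = ∑ γ, jac p f γ ε x * zOp p γ u (f x) := by
  rw [zOp, act_comp _ hu (hf.differentiableAt hN hx), hf.pushforward_frameZ hp hx, act_sum_vec]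
  simp only [act_smul_vec, zOp]

/-- Chain rule for `Z_ε̄`. -/
theorem zbOp_comp {u : Pt ι → ℂ} {x : Pt ι} (hx : x ∈ N) (hu : DifferentiableAt ℝ u (f x))
    (ε : ι) :
    zbOp p ε (fun y => u (f y)) x = ∑ γ, conj (jac p f γ ε x) * zbOp p γ u (f x) := by
  rw [zbOp, act_comp _ hu (hf.differentiableAt hN hx), hf.pushforward_frameZbar hp hx, act_sum_vec]
  simp only [act_smul_vec, zbOp]

omit hp in
/-- Chain rule for `T`, for functions that do not depend on `t`. -/
theorem tOp_comp {u : Pt ι → ℂ} {x : Pt ι} (hx : x ∈ N) (hu : DifferentiableAt ℝ u (f x))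
    (ht : tOp u (f x) = 0) :
    tOp (fun y => u (f y)) x = ∑ γ, (drift f γ x * zOp p γ u (f x)
      + conj (drift f γ x) * zbOp p γ u (f x)) := by
  have h : ∀ v : CTan ι, act v u (f x)
      = ∑ γ, (v.1 γ * zOp p γ u (f x) + v.2.1 γ * zbOp p γ u (f x)) := by
    intro v
    have ht' := ht
    rw [tOp_eq] at ht'
    have hz : ∀ γ, zOp p γ u (f x) = dz u (f x) γ := by
      intro γ
      simp [zOp, frameZ, act, ht', Pi.single_apply]
    have hzb : ∀ γ, zbOp p γ u (f x) = dzbar u (f x) γ := by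
      intro γ
      simp [zbOp, frameZbar_eq, act, ht', Pi.single_apply]
    simp only [act, ht', hz, hzb, mul_zero, add_zero]
  rw [tOp, act_comp _ hu (hf.differentiableAt hN hx), h]
  have h2 : ∀ γ, (pushforward f x (reeb x)).2.1 γ = conj (drift f γ x) :=
    fun γ => tOp_conj _ _
  simp only [h2]
  rfl

/-- `Z_μ̄ J^γ_α = i h_{αμ̄} a^γ`, as `z^γ ∘ f` is a CR function. -/
theorem zbOp_jac {x : Pt ι} (hx : x ∈ N) (μ γ α : ι) :
    zbOp p μ (jac p f γ α) x = Complex.I * leviMatrix p x α μ * drift f γ x := by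
  have h := zOp_zbOp_comm hp hN (hf.contDiffOn_coord γ) hx α μ
  have h0 : zOp p α (zbOp p μ (fun y => (f y).1 γ)) x = 0 :=
    (act_congr _ hN hx fun y hy => hf.zbOp_coord hp hy μ γ).trans (act_const _ _ _)
  rw [h0] at h
  have h1 : zbOp p μ (jac p f γ α) x = zbOp p μ (zOp p α (fun y => (f y).1 γ)) x := rfl
  rw [h1, drift]
  linear_combination -h

theorem zOp_conj_jac {x : Pt ι} (hx : x ∈ N) (ε δ β : ι) :
    zOp p ε (fun y => conj (jac p f δ β y)) x
      = -Complex.I * leviMatrix p x ε β * conj (drift f δ x) := by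
  rw [zOp_conj, hf.zbOp_jac hp hN hx]
  simp [conj_leviMatrix hp]

theorem tOp_jac {x : Pt ι} (hx : x ∈ N) (γ α : ι) :
    tOp (jac p f γ α) x = zOp p α (drift f γ) x :=
  tOp_zOp hp hN (hf.contDiffOn_coord γ) hx α

theorem zbOp_drift {x : Pt ι} (hx : x ∈ N) (γ β : ι) : zbOp p β (drift f γ) x = 0 := by
  have h := tOp_zbOp hp hN (hf.contDiffOn_coord γ) hx β
  refine h.symm.trans ?_
  exact (act_congr _ hN hx fun y hy => hf.zbOp_coord hp hy β γ).trans (act_const _ _ _)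

/-- `h(f_* Z_α, f_* Z_β̄) = lam h(Z_α, Z_β̄)`, from the bracket `[Z_α, Z_β̄]` applied to `t ∘ f`. -/
theorem leviMatrix_pullback {x : Pt ι} (hx : x ∈ N) (α β : ι) :
    ∑ γ, jac p f γ α x * ∑ δ, leviMatrix p (f x) γ δ * conj (jac p f δ β x)
      = clam lam x * leviMatrix p x α β := by
  have hd := fun {g : Pt ι → ℂ} (hg : ContDiffOn ℝ ∞ g N) => differentiableAt_of_contDiffOn hN hg hx
  have hJ := fun γ α => hf.contDiffOn_jac hp hN γ α
  have hcJ := fun γ α => contDiffOn_conj (hJ γ α)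
  have hP : ∀ γ, ContDiffOn ℝ ∞ (fun y => pz p (f y) γ) N := fun γ =>
    hf.contDiffOn_comp (contDiff_pz hp γ).contDiffOn
  have hPb : ∀ γ, ContDiffOn ℝ ∞ (fun y => pzbar p (f y) γ) N := fun γ =>
    hf.contDiffOn_comp (contDiff_pzbar hp γ).contDiffOn
  have h := zOp_zbOp_comm hp hN hf.contDiffOn_time hx α β
  have e1 : zbOp p β (zOp p α (fun y => ((f y).2 : ℂ))) x = Complex.I * ∑ γ,
      ((∑ δ, conj (jac p f δ β x) * zbOp p δ (fun y => pz p y γ) (f x)) * jac p f γ α x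
        + pz p (f x) γ * (Complex.I * leviMatrix p x α β * drift f γ x)) := by
    rw [zbOp, act_congr _ hN hx fun y hy => hf.zOp_time hp hy α,
      act_const_mul _ _ (hd (ContDiffOn.sum fun γ _ => (hP γ).mul (hJ γ α))),
      act_sum_mul _ _ (fun γ => hd (hP γ)) (fun γ => hd (hJ γ α))]
    simp only [← hf.zbOp_comp hp hN hx (differentiableAt_pz hp _ (f x)), ← hf.zbOp_jac hp hN hx]
    rfl
  have e2 : zOp p α (zbOp p β (fun y => ((f y).2 : ℂ))) x = -Complex.I * ∑ γ,
      ((∑ δ, jac p f δ α x * zOp p δ (fun y => pzbar p y γ) (f x)) * conj (jac p f γ β x)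
        + pzbar p (f x) γ * (-Complex.I * leviMatrix p x α β * conj (drift f γ x))) := by
    rw [zOp, act_congr _ hN hx fun y hy => hf.zbOp_time hp hy β,
      act_const_mul _ _ (hd (ContDiffOn.sum fun γ _ => (hPb γ).mul (hcJ γ β))),
      act_sum_mul _ _ (fun γ => hd (hPb γ)) (fun γ => hd (hcJ γ β))]
    simp only [← hf.zOp_comp hp hN hx (differentiableAt_pzbar hp _ (f x)),
      ← hf.zOp_conj_jac hp hN hx]
    rfl
  rw [e1, e2, hf.tOp_time hx] at h
  have e3 : ∑ γ, jac p f γ α x * ∑ δ, leviMatrix p (f x) γ δ * conj (jac p f δ β x)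
      = (∑ γ, (∑ δ, jac p f δ α x * zOp p δ (fun y => pzbar p y γ) (f x))
          * conj (jac p f γ β x))
        + ∑ γ, (∑ δ, conj (jac p f δ β x) * zbOp p δ (fun y => pz p y γ) (f x))
          * jac p f γ α x := by
    simp only [leviMatrix_apply hp, add_mul, Finset.sum_add_distrib, mul_add, Finset.mul_sum,
      Finset.sum_mul]
    rw [Finset.sum_comm]
    congr 1 <;> exact Finset.sum_congr rfl fun γ _ => Finset.sum_congr rfl fun δ _ => by ring
  rw [e3]
  simp only [Finset.sum_add_distrib, Finset.sum_sub_distrib] at h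
  have e4 : ∑ γ, pz p (f x) γ * (Complex.I * leviMatrix p x α β * drift f γ x)
      = Complex.I * leviMatrix p x α β * ∑ γ, pz p (f x) γ * drift f γ x := by
    rw [Finset.mul_sum]
    exact Finset.sum_congr rfl fun γ _ => by ring
  have e5 : ∑ γ, pzbar p (f x) γ * (-Complex.I * leviMatrix p x α β * conj (drift f γ x))
      = -Complex.I * leviMatrix p x α β * ∑ γ, pzbar p (f x) γ * conj (drift f γ x) := by
    rw [Finset.mul_sum]
    exact Finset.sum_congr rfl fun γ _ => by ring
  rw [e4, e5] at h
  apply mul_left_cancel₀ (neg_ne_zero.2 Complex.I_ne_zero)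
  linear_combination h

/-- `L(f_* Z_α, a^δ̄ Z_δ̄) = -i Z_α lam` for the `(1,0)` part `a` of `f_* T`, from the bracket
`[T, Z_α]` applied to `t ∘ f`. -/
theorem zOp_clam {x : Pt ι} (hx : x ∈ N) (α : ι) :
    Complex.I * ∑ γ, jac p f γ α x * ∑ δ, leviMatrix p (f x) γ δ * conj (drift f δ x)
      = zOp p α (clam lam) x := by
  have hd := fun {g : Pt ι → ℂ} (hg : ContDiffOn ℝ ∞ g N) => differentiableAt_of_contDiffOn hN hg hx
  have hJ := fun γ α => hf.contDiffOn_jac hp hN γ α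
  have ha := fun γ => hf.contDiffOn_drift hN γ
  have hca := fun γ => contDiffOn_conj (ha γ)
  have hP : ∀ γ, ContDiffOn ℝ ∞ (fun y => pz p (f y) γ) N := fun γ =>
    hf.contDiffOn_comp (contDiff_pz hp γ).contDiffOn
  have hPb : ∀ γ, ContDiffOn ℝ ∞ (fun y => pzbar p (f y) γ) N := fun γ =>
    hf.contDiffOn_comp (contDiff_pzbar hp γ).contDiffOn
  have h := tOp_zOp hp hN hf.contDiffOn_time hx α
  have e1 : tOp (zOp p α (fun y => ((f y).2 : ℂ))) x = Complex.I * ∑ γ,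
      ((∑ δ, (drift f δ x * zOp p δ (fun y => pz p y γ) (f x)
          + conj (drift f δ x) * zbOp p δ (fun y => pz p y γ) (f x))) * jac p f γ α x
        + pz p (f x) γ * zOp p α (drift f γ) x) := by
    rw [tOp, act_congr _ hN hx fun y hy => hf.zOp_time hp hy α,
      act_const_mul _ _ (hd (ContDiffOn.sum fun γ _ => (hP γ).mul (hJ γ α))),
      act_sum_mul _ _ (fun γ => hd (hP γ)) (fun γ => hd (hJ γ α))]
    simp only [← hf.tOp_comp hN hx (differentiableAt_pz hp _ (f x)) (tOp_pz hp _ (f x)),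
      ← hf.tOp_jac hp hN hx]
    rfl
  have h0 : ∀ γ, zOp p α (fun y => conj (drift f γ y)) x = 0 := by
    intro γ
    rw [zOp_conj, hf.zbOp_drift hp hN hx, map_zero]
  have e2 : zOp p α (tOp (fun y => ((f y).2 : ℂ))) x = zOp p α (clam lam) x
      + Complex.I * (∑ γ,
      ((∑ δ, jac p f δ α x * zOp p δ (fun y => pz p y γ) (f x)) * drift f γ x
        + pz p (f x) γ * zOp p α (drift f γ) x)
      - ∑ γ, ((∑ δ, jac p f δ α x * zOp p δ (fun y => pzbar p y γ) (f x)) * conj (drift f γ x)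
        + pzbar p (f x) γ * zOp p α (fun y => conj (drift f γ y)) x)) := by
    have e : ∀ y ∈ N, tOp (fun y => ((f y).2 : ℂ)) y = clam lam y
      + Complex.I * (∑ γ, pz p (f y) γ * drift f γ y
        - ∑ γ, pzbar p (f y) γ * conj (drift f γ y)) := by
      intro y hy
      rw [hf.tOp_time hy, Finset.sum_sub_distrib]
    have s1 : ContDiffOn ℝ ∞ (fun y => ∑ γ, pz p (f y) γ * drift f γ y) N :=
      ContDiffOn.sum fun γ _ => (hP γ).mul (ha γ)
    have s2 : ContDiffOn ℝ ∞ (fun y => ∑ γ, pzbar p (f y) γ * conj (drift f γ y)) N :=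
      ContDiffOn.sum fun γ _ => (hPb γ).mul (hca γ)
    rw [zOp, act_congr _ hN hx e, act_add _ (hd (hf.contDiffOn_clam hp hN))
      ((hd (s1.sub s2)).const_mul _), act_const_mul _ _ (hd (s1.sub s2)),
      act_sub _ (hd s1) (hd s2), act_sum_mul _ _ (fun γ => hd (hP γ)) (fun γ => hd (ha γ)),
      act_sum_mul _ _ (fun γ => hd (hPb γ)) (fun γ => hd (hca γ))]
    simp only [← hf.zOp_comp hp hN hx (differentiableAt_pz hp _ (f x)),
      ← hf.zOp_comp hp hN hx (differentiableAt_pzbar hp _ (f x))]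
    rfl
  rw [e1, e2] at h
  simp only [h0, mul_zero, add_zero, Finset.sum_add_distrib, add_mul] at h
  have e3 : ∑ γ, jac p f γ α x * ∑ δ, leviMatrix p (f x) γ δ * conj (drift f δ x)
      = (∑ γ, (∑ δ, jac p f δ α x * zOp p δ (fun y => pzbar p y γ) (f x))
          * conj (drift f γ x))
        + ∑ γ, (∑ δ, conj (drift f δ x) * zbOp p δ (fun y => pz p y γ) (f x))
          * jac p f γ α x := by
    simp only [leviMatrix_apply hp, add_mul, Finset.sum_add_distrib, mul_add, Finset.mul_sum,
      Finset.sum_mul]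
    rw [Finset.sum_comm]
    congr 1 <;> exact Finset.sum_congr rfl fun γ _ => Finset.sum_congr rfl fun δ _ => by ring
  -- the second derivatives `Z_δ p_γ` are symmetric
  have e4 : ∑ γ, (∑ δ, drift f δ x * zOp p δ (fun y => pz p y γ) (f x)) * jac p f γ α x
      = ∑ γ, (∑ δ, jac p f δ α x * zOp p δ (fun y => pz p y γ) (f x)) * drift f γ x := by
    simp only [Finset.sum_mul]
    rw [Finset.sum_comm]
    refine Finset.sum_congr rfl fun γ _ => Finset.sum_congr rfl fun δ _ => ?_
    rw [zOp_pz_symm hp γ δ]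
    ring
  rw [e3]
  rw [e4] at h
  linear_combination h

end First

/-! ### Transformation of the connection and of the curvature -/

section Second

variable (hN' : IsOpen N') (hdet : ∀ x ∈ N, (leviMatrix p x).det ≠ 0)
  (hdet' : ∀ x ∈ N', (leviMatrix p x).det ≠ 0)
include hp hN hf

/-- The form `h(Z_γ, f_* Z_β̄)` at `f x`. -/
noncomputable def mixed (p : (ι → ℂ) → ℝ) (f : Pt ι → Pt ι) (γ β : ι) (x : Pt ι) : ℂ :=
  ∑ δ, leviMatrix p (f x) γ δ * conj (jac p f δ β x)

theorem jac_mul_mixed {x : Pt ι} (hx : x ∈ N) :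
    (Matrix.of fun γ α => jac p f γ α x).transpose * Matrix.of (fun γ β => mixed p f γ β x)
      = clam lam x • leviMatrix p x := by
  ext α β
  rw [Matrix.mul_apply]
  exact hf.leviMatrix_pullback hp hN hx α β

include hdet

theorem det_jac_mul_det_mixed {x : Pt ι} (hx : x ∈ N) :
    (Matrix.of fun γ α => jac p f γ α x).det * (Matrix.of fun γ β => mixed p f γ β x).det
      ≠ 0 := by
  have h := congrArg Matrix.det (hf.jac_mul_mixed hp hN hx)
  rw [Matrix.det_mul, Matrix.det_transpose, Matrix.det_smul] at h
  rw [h]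
  exact mul_ne_zero (pow_ne_zero _ (hf.clam_ne_zero hx)) (hdet x hx)

/-- A vector orthogonal to all `f_* Z_β̄` vanishes. -/
theorem eq_zero_of_mixed {x : Pt ι} (hx : x ∈ N) {e : ι → ℂ}
    (h : ∀ β, ∑ γ, e γ * mixed p f γ β x = 0) : e = 0 := by
  refine Matrix.eq_zero_of_vecMul_eq_zero
    (right_ne_zero_of_mul (hf.det_jac_mul_det_mixed hp hN hdet hx)) ?_
  funext β
  exact h β

omit hdet
include hdet'

/-- The connection forms of `∇` at `f x`, along `f_* Z_ε`. -/
noncomputable def pullConn (p : (ι → ℂ) → ℝ) (f : Pt ι → Pt ι) (ε σ γ : ι) (x : Pt ι) : ℂ :=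
  ∑ μ, jac p f μ ε x * christoffel p μ (f x) σ γ

/-- The derivative of `h(Z_γ, f_* Z_β̄)`: a connection term, and a term from `Z_ε J̄`. -/
theorem zOp_mixed {x : Pt ι} (hx : x ∈ N) (ε γ β : ι) :
    zOp p ε (mixed p f γ β) x = ∑ σ, pullConn p f ε σ γ x * mixed p f σ β x
      - Complex.I * leviMatrix p x ε β * ∑ δ, leviMatrix p (f x) γ δ * conj (drift f δ x) := by
  have hd := fun {g : Pt ι → ℂ} (hg : ContDiffOn ℝ ∞ g N) => differentiableAt_of_contDiffOn hN hg hx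
  have hJ := fun γ α => hf.contDiffOn_jac hp hN γ α
  have hH : ∀ γ δ, ContDiffOn ℝ ∞ (fun y => leviMatrix p (f y) γ δ) N := fun γ δ =>
    hf.contDiffOn_comp (contDiff_leviMatrix hp γ δ).contDiffOn
  have h1 : zOp p ε (mixed p f γ β) x = ∑ δ, (zOp p ε (fun y => leviMatrix p (f y) γ δ) x
      * conj (jac p f δ β x)
      + leviMatrix p (f x) γ δ * zOp p ε (fun y => conj (jac p f δ β y)) x) :=
    act_sum_mul _ _ (fun δ => hd (hH γ δ)) (fun δ => hd (contDiffOn_conj (hJ δ β)))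
  have hLd : ∀ δ, DifferentiableAt ℝ (fun y => leviMatrix p y γ δ) (f x) := fun δ =>
    (contDiff_leviMatrix hp γ δ).contDiffAt.differentiableAt (by simp)
  have h2 : ∀ δ, zOp p ε (fun y => leviMatrix p (f y) γ δ) x
      = ∑ σ, pullConn p f ε σ γ x * leviMatrix p (f x) σ δ := by
    intro δ
    rw [hf.zOp_comp hp hN hx (hLd δ)]
    simp only [zOp_leviMatrix (hdet' _ (hf.mapsTo hx)), pullConn, Finset.mul_sum, Finset.sum_mul]
    rw [Finset.sum_comm]
    exact Finset.sum_congr rfl fun γ _ => Finset.sum_congr rfl fun δ _ => by ring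
  rw [h1]
  simp only [h2, hf.zOp_conj_jac hp hN hx, Finset.sum_add_distrib, mixed, Finset.mul_sum,
    Finset.sum_mul]
  rw [Finset.sum_comm, sub_eq_add_neg, ← Finset.sum_neg_distrib]
  congr 1
  · exact Finset.sum_congr rfl fun γ _ => Finset.sum_congr rfl fun δ _ => by ring
  · exact Finset.sum_congr rfl fun γ _ => by ring

include hdet

/-- Transformation of the connection: `f^*∇ - ∇` is `u_ε δ^σ_α + u_α δ^σ_ε`, with
`u = log lam`. -/
theorem zOp_jac {x : Pt ι} (hx : x ∈ N) (ε γ α : ι) :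
    zOp p ε (jac p f γ α) x + ∑ ν, pullConn p f ε γ ν x * jac p f ν α x
      = ∑ σ, jac p f γ σ x * christoffel p ε x σ α + logGrad p lam ε x * jac p f γ α x
        + logGrad p lam α x * jac p f γ ε x := by
  have hd := fun {g : Pt ι → ℂ} (hg : ContDiffOn ℝ ∞ g N) => differentiableAt_of_contDiffOn hN hg hx
  have hJ := fun γ α => hf.contDiffOn_jac hp hN γ α
  have hM : ∀ γ β, ContDiffOn ℝ ∞ (mixed p f γ β) N := fun γ β =>
    ContDiffOn.sum fun δ _ => (hf.contDiffOn_comp (contDiff_leviMatrix hp γ δ).contDiffOn).mul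
      (contDiffOn_conj (hJ δ β))
  have hl := hf.clam_ne_zero hx
  have hu : ∀ ε, zOp p ε (clam lam) x = logGrad p lam ε x * clam lam x := by
    intro ε
    rw [logGrad]
    field_simp
  refine sub_eq_zero.1 (congrFun (hf.eq_zero_of_mixed hp hN hdet hx (e := fun γ =>
    zOp p ε (jac p f γ α) x + ∑ ν, pullConn p f ε γ ν x * jac p f ν α x
      - (∑ σ, jac p f γ σ x * christoffel p ε x σ α + logGrad p lam ε x * jac p f γ α x
        + logGrad p lam α x * jac p f γ ε x)) ?_) γ)
  intro β
  have h1 : zOp p ε (fun y => ∑ γ, jac p f γ α y * mixed p f γ β y) x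
      = zOp p ε (fun y => clam lam y * leviMatrix p y α β) x :=
    act_congr _ hN hx fun y hy => hf.leviMatrix_pullback hp hN hy α β
  have h2 : zOp p ε (fun y => ∑ γ, jac p f γ α y * mixed p f γ β y) x
      = ∑ γ, (zOp p ε (jac p f γ α) x * mixed p f γ β x
        + jac p f γ α x * zOp p ε (mixed p f γ β) x) :=
    act_sum_mul _ _ (fun γ => hd (hJ γ α)) (fun γ => hd (hM γ β))
  have h3 : zOp p ε (fun y => clam lam y * leviMatrix p y α β) x
      = zOp p ε (clam lam) x * leviMatrix p x α β
        + clam lam x * zOp p ε (fun y => leviMatrix p y α β) x :=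
    act_mul _ (hd (hf.contDiffOn_clam hp hN)) (hd (contDiff_leviMatrix hp α β).contDiffOn)
  rw [h2, h3, zOp_leviMatrix (hdet x hx), hu] at h1
  simp only [hf.zOp_mixed hp hN hdet' hx] at h1
  have h4 := hf.zOp_clam hp hN hx α
  rw [hu] at h4
  have p1 := fun α => hf.leviMatrix_pullback hp hN hx α β
  simp only [sub_mul, add_mul, Finset.sum_sub_distrib, Finset.sum_add_distrib]
  have q1 : ∑ γ, (∑ ν, pullConn p f ε γ ν x * jac p f ν α x) * mixed p f γ β x
      = ∑ γ, jac p f γ α x * ∑ σ, pullConn p f ε σ γ x * mixed p f σ β x := by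
    simp only [Finset.sum_mul, Finset.mul_sum]
    rw [Finset.sum_comm]
    exact Finset.sum_congr rfl fun γ _ => Finset.sum_congr rfl fun δ _ => by ring
  have q2 : ∑ γ, (∑ σ, jac p f γ σ x * christoffel p ε x σ α) * mixed p f γ β x
      = clam lam x * ∑ σ, christoffel p ε x σ α * leviMatrix p x σ β := by
    have : ∀ σ, clam lam x * (christoffel p ε x σ α * leviMatrix p x σ β)
        = christoffel p ε x σ α * ∑ γ, jac p f γ σ x * mixed p f γ β x := by
      intro σ
      have := p1 σ
      simp only [mixed]
      rw [this]
      ring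
    simp only [Finset.sum_mul, Finset.mul_sum, this]
    rw [Finset.sum_comm]
    exact Finset.sum_congr rfl fun γ _ => Finset.sum_congr rfl fun δ _ => by ring
  have q3 : ∀ (c : ℂ) (α : ι), ∑ γ, c * jac p f γ α x * mixed p f γ β x
      = c * (clam lam x * leviMatrix p x α β) := by
    intro c α
    rw [← p1, Finset.mul_sum]
    exact Finset.sum_congr rfl fun γ _ => by rw [mixed]; ring
  rw [q1, q2, q3, q3]
  have q4 : ∑ γ, jac p f γ α x * (Complex.I * leviMatrix p x ε β
      * ∑ δ, leviMatrix p (f x) γ δ * conj (drift f δ x))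
      = leviMatrix p x ε β * (logGrad p lam α x * clam lam x) := by
    rw [← h4, Finset.mul_sum, Finset.mul_sum]
    exact Finset.sum_congr rfl fun γ _ => by ring
  simp only [mul_sub, Finset.sum_sub_distrib, Finset.sum_add_distrib, q4] at h1
  linear_combination h1

end Second

end IsCRDiffeo
end CRMap

section CRMap

variable {ι : Type} [Fintype ι] [DecidableEq ι] {p : (ι → ℂ) → ℝ}
variable {f : Pt ι → Pt ι} {N N' : Set (Pt ι)} {lam : Pt ι → ℝ}

namespace IsCRDiffeo

/-- The curvature `R(f_* Z_ε, f_* Z_μ̄)` at `f x`, as a matrix in the frame `Z_γ`. -/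
noncomputable def pullCurv (p : (ι → ℂ) → ℝ) (f : Pt ι → Pt ι) (ε μ γ ν : ι) (x : Pt ι) : ℂ :=
  ∑ ρ, jac p f ρ ε x * ∑ τ, conj (jac p f τ μ x) * curvMatrix p ρ τ (f x) γ ν

/-- The connection forms of `∇` at `f x`, along the `(1,0)` part of `f_* T`. -/
noncomputable def driftConn (p : (ι → ℂ) → ℝ) (f : Pt ι → Pt ι) (γ ν : ι) (x : Pt ι) : ℂ :=
  ∑ ρ, drift f ρ x * christoffel p ρ (f x) γ ν

/-- The tensor `i (∇_α a^γ - a^γ u_α)`, where `∇` is pulled back by `f` and `u = log lam`. -/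
noncomputable def driftHess (p : (ι → ℂ) → ℝ) (f : Pt ι → Pt ι) (lam : Pt ι → ℝ) (γ α : ι)
    (x : Pt ι) : ℂ :=
  Complex.I * (zOp p α (drift f γ) x + ∑ ν, driftConn p f γ ν x * jac p f ν α x
    - drift f γ x * logGrad p lam α x)

variable (hp : ContDiff ℝ ∞ p) (hN : IsOpen N) (hf : IsCRDiffeo p f N N' lam)
variable (hN' : IsOpen N') (hdet : ∀ x ∈ N, (leviMatrix p x).det ≠ 0)
  (hdet' : ∀ x ∈ N', (leviMatrix p x).det ≠ 0)

include hp hN hf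

theorem contDiffOn_logGrad (ε : ι) : ContDiffOn ℝ ∞ (logGrad p lam ε) N :=
  ((hf.contDiffOn_clam hp hN).inv fun _ hx => hf.clam_ne_zero hx).mul
    (contDiffOn_zOp hp hN (hf.contDiffOn_clam hp hN) ε)

omit hp hN in
theorem zOp_clam_eq {x : Pt ι} (hx : x ∈ N) (ε : ι) :
    zOp p ε (clam lam) x = clam lam x * logGrad p lam ε x := by
  have := hf.clam_ne_zero hx
  rw [logGrad]
  field_simp

/-- The complex Hessian `Z_μ̄ Z_ε log lam` is Hermitian up to a multiple of the Levi form. -/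
theorem conj_zbOp_logGrad {x : Pt ι} (hx : x ∈ N) :
    ∃ c : ℂ, ∀ ε μ, conj (zbOp p ε (logGrad p lam μ) x)
      = zbOp p μ (logGrad p lam ε) x + c * leviMatrix p x ε μ := by
  have hl := hf.clam_ne_zero hx
  have hd := fun {g : Pt ι → ℂ} (hg : ContDiffOn ℝ ∞ g N) => differentiableAt_of_contDiffOn hN hg hx
  have hs := hf.contDiffOn_clam hp hN
  have hreal : (fun y => conj (clam lam y)) = clam lam := by
    funext y
    exact Complex.conj_ofReal _
  have hzb : ∀ ε, zbOp p ε (clam lam) x = clam lam x * conj (logGrad p lam ε x) := by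
    intro ε
    have h := zbOp_conj p ε (clam lam) x
    rw [hreal, hf.zOp_clam_eq hx, map_mul] at h
    rw [h]
    congr 1
    exact Complex.conj_ofReal _
  have key : ∀ ε μ, clam lam x * zbOp p μ (logGrad p lam ε) x
      = zbOp p μ (zOp p ε (clam lam)) x
        - clam lam x * conj (logGrad p lam μ x) * logGrad p lam ε x := by
    intro ε μ
    have h : zbOp p μ (zOp p ε (clam lam)) x
        = zbOp p μ (clam lam) x * logGrad p lam ε x
          + clam lam x * zbOp p μ (logGrad p lam ε) x :=
      (act_congr _ hN hx fun y hy => hf.zOp_clam_eq hy ε).trans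
        (act_mul _ (hd hs) (hd (hf.contDiffOn_logGrad hp hN ε)))
    rw [h, hzb]
    ring
  refine ⟨-Complex.I * tOp (clam lam) x / clam lam x, fun ε μ => ?_⟩
  apply mul_left_cancel₀ hl
  have h1 : clam lam x * conj (zbOp p ε (logGrad p lam μ) x)
      = zOp p ε (zbOp p μ (clam lam)) x
        - clam lam x * logGrad p lam ε x * conj (logGrad p lam μ x) := by
    have h := congrArg conj (key μ ε)
    simp only [map_sub, map_mul, Complex.conj_conj] at h
    rw [← zOp_conj p ε (zOp p μ (clam lam))] at h
    have h2 : (fun y => conj (zOp p μ (clam lam) y)) = zbOp p μ (clam lam) := by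
      funext y
      rw [← zbOp_conj, hreal]
    have h3 : conj (clam lam x) = clam lam x := Complex.conj_ofReal _
    rw [h2, h3] at h
    exact h
  have h4 := zOp_zbOp_comm hp hN hs hx ε μ
  rw [h1, mul_add, key]
  field_simp
  linear_combination h4

include hN' hdet'

theorem zbOp_pullConn {x : Pt ι} (hx : x ∈ N) (ε μ γ ν : ι) :
    zbOp p μ (pullConn p f ε γ ν) x
      = Complex.I * leviMatrix p x ε μ * driftConn p f γ ν x - pullCurv p f ε μ γ ν x := by
  have hd := fun {g : Pt ι → ℂ} (hg : ContDiffOn ℝ ∞ g N) => differentiableAt_of_contDiffOn hN hg hx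
  have hG := fun ρ => contDiffOn_christoffel hp hN' hdet' ρ γ ν
  have h1 : zbOp p μ (pullConn p f ε γ ν) x = ∑ ρ, (zbOp p μ (jac p f ρ ε) x
      * christoffel p ρ (f x) γ ν
      + jac p f ρ ε x * zbOp p μ (fun y => christoffel p ρ (f y) γ ν) x) :=
    act_sum_mul _ _ (fun ρ => hd (hf.contDiffOn_jac hp hN ρ ε))
      (fun ρ => hd (hf.contDiffOn_comp (hG ρ)))
  have h2 : ∀ ρ, zbOp p μ (fun y => christoffel p ρ (f y) γ ν) x
      = -∑ τ, conj (jac p f τ μ x) * curvMatrix p ρ τ (f x) γ ν := by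
    intro ρ
    rw [hf.zbOp_comp hp hN hx
      (differentiableAt_of_contDiffOn hN' (hG ρ) (hf.mapsTo hx)) (u := fun y =>
        christoffel p ρ y γ ν), ← Finset.sum_neg_distrib]
    refine Finset.sum_congr rfl fun τ _ => ?_
    simp [curvMatrix]
  rw [h1]
  simp only [h2, hf.zbOp_jac hp hN hx, mul_neg, driftConn, pullCurv, Finset.mul_sum,
    ← sub_eq_add_neg, Finset.sum_sub_distrib]
  congr 1
  exact Finset.sum_congr rfl fun ρ _ => by ring

include hdet

/-- Transformation of the curvature: `f^* R - R` is built algebraically from the Levi form, the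
complex Hessian of `log lam` and the derivative of the `(1,0)` part of `f_* T`. -/
theorem pullCurv_sub {x : Pt ι} (hx : x ∈ N) (ε μ γ α : ι) :
    ∑ ν, pullCurv p f ε μ γ ν x * jac p f ν α x - ∑ σ, jac p f γ σ x * curvMatrix p ε μ x σ α
      = leviMatrix p x ε μ * driftHess p f lam γ α x + leviMatrix p x α μ * driftHess p f lam γ ε x
        - jac p f γ α x * zbOp p μ (logGrad p lam ε) x
        - jac p f γ ε x * zbOp p μ (logGrad p lam α) x := by
  have hd := fun {g : Pt ι → ℂ} (hg : ContDiffOn ℝ ∞ g N) => differentiableAt_of_contDiffOn hN hg hx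
  have hJ := fun γ α => hf.contDiffOn_jac hp hN γ α
  have hPC : ∀ ν, ContDiffOn ℝ ∞ (pullConn p f ε γ ν) N := fun ν =>
    ContDiffOn.sum fun μ _ => (hJ μ ε).mul
      (hf.contDiffOn_comp (contDiffOn_christoffel hp hN' hdet' μ γ ν))
  have hG := fun σ => contDiffOn_christoffel hp hN hdet ε σ α
  have hlg := fun ε => hf.contDiffOn_logGrad hp hN ε
  -- apply `Z_μ̄` to the transformation law of the connection
  have h := act_congr (frameZbar p μ x) hN hx
    fun y hy => hf.zOp_jac hp hN hdet hdet' hy ε γ α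
  have s1 : ContDiffOn ℝ ∞ (fun y => ∑ ν, pullConn p f ε γ ν y * jac p f ν α y) N :=
    ContDiffOn.sum fun ν _ => (hPC ν).mul (hJ ν α)
  have s2 : ContDiffOn ℝ ∞ (fun y => ∑ σ, jac p f γ σ y * christoffel p ε y σ α) N :=
    ContDiffOn.sum fun σ _ => (hJ γ σ).mul (hG σ)
  have s3 := fun ε α => (hlg ε).mul (hJ γ α)
  rw [act_add _ (hd (contDiffOn_zOp hp hN (hJ γ α) ε)) (hd s1),
    act_sum_mul _ _ (fun ν => hd (hPC ν)) (fun ν => hd (hJ ν α)),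
    act_add _ (hd (s2.add (s3 ε α))) (hd (s3 α ε)), act_add _ (hd s2) (hd (s3 ε α)),
    act_sum_mul _ _ (fun σ => hd (hJ γ σ)) (fun σ => hd (hG σ)),
    act_mul _ (hd (hlg ε)) (hd (hJ γ α)), act_mul _ (hd (hlg α)) (hd (hJ γ ε))] at h
  have hz : ∀ g : Pt ι → ℂ, act (frameZbar p μ x) g x = zbOp p μ g x := fun _ => rfl
  simp only [hz] at h
  have h1 : zbOp p μ (fun y => zOp p ε (jac p f γ α) y) x
      = Complex.I * ((∑ σ, christoffel p ε x σ α * leviMatrix p x σ μ) * drift f γ x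
        + leviMatrix p x α μ * zOp p ε (drift f γ) x
        + leviMatrix p x ε μ * zOp p α (drift f γ) x) := by
    have hc := zOp_zbOp_comm hp hN (hJ γ α) hx ε μ
    have hL := (contDiff_leviMatrix hp α μ).contDiffOn (s := N)
    have e1 : zOp p ε (zbOp p μ (jac p f γ α)) x
        = Complex.I * (zOp p ε (fun y => leviMatrix p y α μ) x * drift f γ x
          + leviMatrix p x α μ * zOp p ε (drift f γ) x) := by
      rw [zOp, act_congr _ hN hx (w := fun y => Complex.I * (leviMatrix p y α μ * drift f γ y))
        fun y hy => by rw [hf.zbOp_jac hp hN hy]; ring]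
      rw [act_const_mul _ _ (hd (hL.mul (hf.contDiffOn_drift hN γ))),
        act_mul _ (hd hL) (hd (hf.contDiffOn_drift hN γ))]
      rfl
    rw [e1, hf.tOp_jac hp hN hx, zOp_leviMatrix (hdet x hx)] at hc
    change zbOp p μ (zOp p ε (jac p f γ α)) x = _
    linear_combination -hc
  have hR : ∀ σ, zbOp p μ (fun y => christoffel p ε y σ α) x = -curvMatrix p ε μ x σ α := by
    intro σ
    simp [curvMatrix]
  simp only [h1, hR, hf.zbOp_pullConn hp hN hN' hdet' hx, hf.zbOp_jac hp hN hx] at h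
  have q1 : ∑ ν, pullConn p f ε γ ν x * (Complex.I * leviMatrix p x α μ * drift f ν x)
      = Complex.I * leviMatrix p x α μ * ∑ ν, driftConn p f γ ν x * jac p f ν ε x := by
    simp only [pullConn, driftConn, Finset.mul_sum, Finset.sum_mul]
    rw [Finset.sum_comm]
    refine Finset.sum_congr rfl fun ρ _ => Finset.sum_congr rfl fun ν _ => ?_
    rw [christoffel_symm hp ρ ν γ]
    ring
  have q2 : ∑ ν, (Complex.I * leviMatrix p x ε μ * driftConn p f γ ν x - pullCurv p f ε μ γ ν x)
        * jac p f ν α x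
      = Complex.I * leviMatrix p x ε μ * ∑ ν, driftConn p f γ ν x * jac p f ν α x
        - ∑ ν, pullCurv p f ε μ γ ν x * jac p f ν α x := by
    simp only [sub_mul, Finset.sum_sub_distrib, Finset.mul_sum]
    congr 1
    exact Finset.sum_congr rfl fun ν _ => by ring
  have q3 : ∑ σ, Complex.I * leviMatrix p x σ μ * drift f γ x * christoffel p ε x σ α
      = Complex.I * ((∑ σ, christoffel p ε x σ α * leviMatrix p x σ μ) * drift f γ x) := by
    simp only [Finset.sum_mul, Finset.mul_sum]
    exact Finset.sum_congr rfl fun σ _ => by ring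
  simp only [Finset.sum_add_distrib, mul_neg, Finset.sum_neg_distrib] at h
  rw [q1, q2, q3] at h
  simp only [driftHess]
  linear_combination -h

end IsCRDiffeo

/-! ### Vanishing of the conformal term -/

/-- Linear algebra behind the theorem: if a curvature difference of the form
`h_{εμ̄} B_α + h_{αμ̄} B_ε - u_{εμ̄} J_α - u_{αμ̄} J_ε` is annihilated by one non-isotropic vector
`X`, and `u` is Hermitian up to a multiple of `h`, then the difference vanishes identically,
because `B = c J` and `u = c h` for the same constant `c`. -/
theorem eq_zero_of_annihilated {h u B J : ι → ι → ℂ} {X : ι → ℂ} {c₀ : ℂ}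
    (hh : ∀ α β, conj (h α β) = h β α)
    (hu : ∀ ε μ, conj (u μ ε) = u ε μ + c₀ * h ε μ)
    (hX : ∑ μ, (∑ α, h α μ * X α) * conj (X μ) ≠ 0)
    (hJ : ∃ γ, ∑ α, J γ α * X α ≠ 0)
    (hann : ∀ ε μ γ, ∑ α, (h ε μ * B γ α + h α μ * B γ ε - J γ α * u ε μ - J γ ε * u α μ) * X α
      = 0) (ε μ γ α : ι) :
    h ε μ * B γ α + h α μ * B γ ε - J γ α * u ε μ - J γ ε * u α μ = 0 := by
  -- contractions with `X` and its conjugate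
  set hx : ι → ℂ := fun μ => ∑ α, h α μ * X α with hhx
  set ux : ι → ℂ := fun μ => ∑ α, u α μ * X α with hux
  set Bx : ι → ℂ := fun γ => ∑ α, B γ α * X α with hBx
  set Jx : ι → ℂ := fun γ => ∑ α, J γ α * X α with hJx
  set hb : ι → ℂ := fun ε => ∑ μ, h ε μ * conj (X μ) with hhb
  set ub : ι → ℂ := fun ε => ∑ μ, u ε μ * conj (X μ) with hub
  set n : ℂ := ∑ μ, hx μ * conj (X μ) with hn
  set w : ℂ := ∑ μ, ux μ * conj (X μ) with hw
  have c1 : ∀ ε μ γ, h ε μ * Bx γ + hx μ * B γ ε - Jx γ * u ε μ - J γ ε * ux μ = 0 := by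
    intro ε μ γ
    rw [← hann ε μ γ]
    simp only [hhx, hux, hBx, hJx, Finset.mul_sum, Finset.sum_mul, ← Finset.sum_add_distrib,
      ← Finset.sum_sub_distrib]
    exact Finset.sum_congr rfl fun α _ => by ring
  -- both slots `α` and `ε` filled with `X`: hence `B X = c J X` and `u(X, ·) = c h(X, ·)`
  have c2 : ∀ μ γ, hx μ * Bx γ = Jx γ * ux μ := by
    intro μ γ
    have e : ∑ ε, (h ε μ * Bx γ + hx μ * B γ ε - Jx γ * u ε μ - J γ ε * ux μ) * X ε
        = hx μ * Bx γ + hx μ * Bx γ - Jx γ * ux μ - Jx γ * ux μ := by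
      have r1 : hx μ * Bx γ = ∑ ε, h ε μ * X ε * Bx γ := by rw [hhx, Finset.sum_mul]
      have r2 : hx μ * Bx γ = ∑ ε, hx μ * (B γ ε * X ε) := by rw [hBx, Finset.mul_sum]
      have r3 : Jx γ * ux μ = ∑ ε, Jx γ * (u ε μ * X ε) := by rw [hux, Finset.mul_sum]
      have r4 : Jx γ * ux μ = ∑ ε, J γ ε * X ε * ux μ := by rw [hJx, Finset.sum_mul]
      nth_rewrite 1 [r1]
      nth_rewrite 1 [r2]
      nth_rewrite 1 [r3]
      nth_rewrite 1 [r4]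
      rw [← Finset.sum_add_distrib, ← Finset.sum_sub_distrib, ← Finset.sum_sub_distrib]
      exact Finset.sum_congr rfl fun ε _ => by ring
    have z : hx μ * Bx γ + hx μ * Bx γ - Jx γ * ux μ - Jx γ * ux μ = 0 := by
      rw [← e]
      exact Finset.sum_eq_zero fun ε _ => by rw [c1, zero_mul]
    linear_combination z / 2
  obtain ⟨γ₀, hγ₀⟩ := hJ
  have hJ0 : Jx γ₀ ≠ 0 := hγ₀
  set c : ℂ := w / n with hc
  have hcn : c * n = w := div_mul_cancel₀ _ hX
  have c3 : ∀ γ, Bx γ = c * Jx γ := by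
    intro γ
    apply mul_left_cancel₀ hX
    have : n * Bx γ = w * Jx γ := by
      rw [hn, hw, Finset.sum_mul, Finset.sum_mul]
      exact Finset.sum_congr rfl fun μ _ => by linear_combination conj (X μ) * c2 μ γ
    rw [this, ← hcn]
    ring
  have c4 : ∀ μ, ux μ = c * hx μ := by
    intro μ
    apply mul_left_cancel₀ hJ0
    rw [← c2, c3]
    ring
  -- the symmetry of `u` carries this over to `u(·, X̄) = c h(·, X̄)`
  have c5 : ∀ ε, conj (hx ε) = hb ε := by
    intro ε
    simp only [hhx, hhb, map_sum, map_mul, hh]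
  have c6 : ∀ ε, ub ε = (conj c - c₀) * hb ε := by
    intro ε
    have h1 : conj (ux ε) = ub ε + c₀ * hb ε := by
      simp only [hux, hub, hhb, map_sum, map_mul, hu, add_mul, Finset.sum_add_distrib,
        Finset.mul_sum, mul_assoc]
    rw [c4, map_mul, c5] at h1
    linear_combination -h1
  have c7 : ∑ ε, hb ε * X ε = n := by
    simp only [hhb, hn, hhx, Finset.sum_mul]
    rw [Finset.sum_comm]
    exact Finset.sum_congr rfl fun _ _ => Finset.sum_congr rfl fun _ _ => by ring
  have c8 : ∑ ε, ub ε * X ε = w := by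
    simp only [hub, hw, hux, Finset.sum_mul]
    rw [Finset.sum_comm]
    exact Finset.sum_congr rfl fun _ _ => Finset.sum_congr rfl fun _ _ => by ring
  have c9 : conj c - c₀ = c := by
    apply mul_right_cancel₀ hX
    rw [hcn, ← c8, ← c7, Finset.mul_sum]
    exact Finset.sum_congr rfl fun ε _ => by rw [c6]; ring
  -- the slots `α` and `μ` filled with `X` and `X̄` give `B = c J`
  have c10 : ∀ γ ε, B γ ε = c * J γ ε := by
    intro γ ε
    apply mul_left_cancel₀ hX
    have z : hb ε * Bx γ + n * B γ ε - Jx γ * ub ε - J γ ε * w = 0 := by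
      have e : ∑ μ, (h ε μ * Bx γ + hx μ * B γ ε - Jx γ * u ε μ - J γ ε * ux μ) * conj (X μ)
          = hb ε * Bx γ + n * B γ ε - Jx γ * ub ε - J γ ε * w := by
        simp only [hhb, hn, hub, hw, Finset.sum_mul, Finset.mul_sum, ← Finset.sum_add_distrib,
          ← Finset.sum_sub_distrib]
        exact Finset.sum_congr rfl fun μ _ => by ring
      rw [← e]
      exact Finset.sum_eq_zero fun μ _ => by rw [c1, zero_mul]
    rw [c6, c9, c3, ← hcn] at z
    linear_combination z
  -- finally only the slot `α` is filled with `X`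
  have c11 : ∀ ε μ, u ε μ = c * h ε μ := by
    intro ε μ
    apply mul_left_cancel₀ hJ0
    have z := c1 ε μ γ₀
    rw [c3, c4, c10] at z
    linear_combination -z
  rw [c10, c10, c11, c11]
  ring

namespace IsCRDiffeo

variable (hp : ContDiff ℝ ∞ p) (hN : IsOpen N) (hf : IsCRDiffeo p f N N' lam)
variable (hN' : IsOpen N') (hdet : ∀ x ∈ N, (leviMatrix p x).det ≠ 0)
  (hdet' : ∀ x ∈ N', (leviMatrix p x).det ≠ 0)

include hp hN hf hN' hdet hdet'

/-- If a non-isotropic vector `X` is annihilated by the curvature at `x` and `f_* X` by the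
curvature at `f x`, then `f` preserves the curvature endomorphisms. -/
theorem curvMatrix_pullback {x : Pt ι} (hx : x ∈ N) {X : ι → ℂ}
    (hX : ∑ μ, (∑ α, leviMatrix p x α μ * X α) * conj (X μ) ≠ 0)
    (hR : ∀ l μ σ, ∑ α, curvMatrix p l μ x σ α * X α = 0)
    (hR' : ∀ l μ σ, ∑ ν, curvMatrix p l μ (f x) σ ν * ∑ α, jac p f ν α x * X α = 0)
    (ε μ γ α : ι) :
    ∑ ν, pullCurv p f ε μ γ ν x * jac p f ν α x
      = ∑ σ, jac p f γ σ x * curvMatrix p ε μ x σ α := by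
  have hsub := fun ε μ γ α => hf.pullCurv_sub hp hN hN' hdet hdet' hx ε μ γ α
  obtain ⟨c₀, hc₀⟩ := hf.conj_zbOp_logGrad hp hN hx
  have hJX : ∃ γ, ∑ α, jac p f γ α x * X α ≠ 0 := by
    by_contra! hcon
    have hX0 : X = 0 := by
      refine Matrix.eq_zero_of_mulVec_eq_zero
        (left_ne_zero_of_mul (hf.det_jac_mul_det_mixed hp hN hdet hx)) ?_
      funext γ
      exact hcon γ
    exact hX (by simp [hX0])
  rw [← sub_eq_zero, hsub]
  refine eq_zero_of_annihilated (h := leviMatrix p x)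
    (u := fun ε μ => zbOp p μ (logGrad p lam ε) x)
    (B := fun γ α => driftHess p f lam γ α x) (J := fun γ α => jac p f γ α x)
    (conj_leviMatrix hp x) hc₀ hX hJX ?_ ε μ γ α
  intro ε μ γ
  simp only [← hsub, sub_mul, Finset.sum_sub_distrib]
  have e1 : ∑ α, (∑ σ, jac p f γ σ x * curvMatrix p ε μ x σ α) * X α = 0 := by
    simp only [Finset.sum_mul]
    rw [Finset.sum_comm]
    refine Finset.sum_eq_zero fun σ _ => ?_
    rw [← mul_zero (jac p f γ σ x), ← hR ε μ σ, Finset.mul_sum]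
    exact Finset.sum_congr rfl fun α _ => by ring
  have e2 : ∑ α, (∑ ν, pullCurv p f ε μ γ ν x * jac p f ν α x) * X α = 0 := by
    have : ∑ α, (∑ ν, pullCurv p f ε μ γ ν x * jac p f ν α x) * X α
        = ∑ ρ, jac p f ρ ε x * ∑ τ, conj (jac p f τ μ x)
          * ∑ ν, curvMatrix p ρ τ (f x) γ ν * ∑ α, jac p f ν α x * X α := by
      obtain ⟨Y, hY⟩ : ∃ Y : ι → ℂ, ∀ ν, ∑ α, jac p f ν α x * X α = Y ν := ⟨_, fun _ => rfl⟩
      have h1 : ∑ α, (∑ ν, pullCurv p f ε μ γ ν x * jac p f ν α x) * X α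
          = ∑ ν, pullCurv p f ε μ γ ν x * Y ν := by
        simp only [← hY, Finset.sum_mul, Finset.mul_sum]
        rw [Finset.sum_comm]
        exact Finset.sum_congr rfl fun ν _ => Finset.sum_congr rfl fun α _ => by ring
      rw [h1]
      simp only [pullCurv, hY, Finset.sum_mul, Finset.mul_sum]
      rw [Finset.sum_comm]
      refine Finset.sum_congr rfl fun ρ _ => ?_
      rw [Finset.sum_comm]
      exact Finset.sum_congr rfl fun τ _ => Finset.sum_congr rfl fun ν _ => by ring
    rw [this]
    simp [hR']
  rw [e1, e2, sub_zero]

omit hN' in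
/-- A CR map that preserves the curvature endomorphisms preserves the Ricci tensor. -/
theorem ricciComp_pullback {x : Pt ι} (hx : x ∈ N)
    (hR : ∀ ε μ γ α, ∑ ν, pullCurv p f ε μ γ ν x * jac p f ν α x
      = ∑ σ, jac p f γ σ x * curvMatrix p ε μ x σ α) (α μ : ι) :
    ∑ ν, jac p f ν α x * ∑ τ, conj (jac p f τ μ x) * ricciComp p (f x) ν τ
      = ricciComp p x α μ := by
  set J : Matrix ι ι ℂ := Matrix.of fun γ α => jac p f γ α x
  have hJ : IsUnit J.det := isUnit_iff_ne_zero.2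
    (left_ne_zero_of_mul (hf.det_jac_mul_det_mixed hp hN hdet hx))
  set K : Matrix ι ι ℂ := J⁻¹
  have hJK : ∀ ρ γ, ∑ ε, jac p f ρ ε x * K ε γ = if ρ = γ then 1 else 0 := by
    intro ρ γ
    have := congrFun (congrFun (Matrix.mul_nonsing_inv J hJ) ρ) γ
    rwa [Matrix.mul_apply, Matrix.one_apply] at this
  have hKJ : ∀ ε σ, ∑ γ, K ε γ * jac p f γ σ x = if ε = σ then 1 else 0 := by
    intro ε σ
    have := congrFun (congrFun (Matrix.nonsing_inv_mul J hJ) ε) σ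
    rwa [Matrix.mul_apply, Matrix.one_apply] at this
  rw [ricciComp_eq hp (hdet x hx)]
  -- trace of `J⁻¹ (f^* R) J = R`
  have h1 : ∑ ε, ∑ γ, K ε γ * ∑ σ, jac p f γ σ x * curvMatrix p ε μ x σ α
      = ∑ l, curvMatrix p l μ x l α := by
    refine Finset.sum_congr rfl fun ε _ => ?_
    calc _ = ∑ σ, (∑ γ, K ε γ * jac p f γ σ x) * curvMatrix p ε μ x σ α := by
          simp only [Finset.mul_sum, Finset.sum_mul]
          rw [Finset.sum_comm]
          exact Finset.sum_congr rfl fun _ _ => Finset.sum_congr rfl fun _ _ => by ring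
      _ = _ := by simp [hKJ]
  have h2 : ∀ ν, ∑ ε, ∑ γ, K ε γ * pullCurv p f ε μ γ ν x
      = ∑ τ, conj (jac p f τ μ x) * ricciComp p (f x) ν τ := by
    intro ν
    set S : ι → ι → ℂ := fun ρ γ => ∑ τ, conj (jac p f τ μ x) * curvMatrix p ρ τ (f x) γ ν
    calc _ = ∑ γ, ∑ ρ, (∑ ε, jac p f ρ ε x * K ε γ) * S ρ γ := by
          simp only [pullCurv, Finset.mul_sum, Finset.sum_mul, S]
          rw [Finset.sum_comm]
          refine Finset.sum_congr rfl fun γ _ => ?_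
          rw [Finset.sum_comm]
          refine Finset.sum_congr rfl fun ρ _ => ?_
          rw [Finset.sum_comm]
          exact Finset.sum_congr rfl fun ε _ => Finset.sum_congr rfl fun τ _ => by ring
      _ = ∑ ρ, S ρ ρ := by simp [hJK]
      _ = _ := by
          simp only [S, ricciComp_eq hp (hdet' _ (hf.mapsTo hx)), Finset.mul_sum]
          rw [Finset.sum_comm]
  rw [← h1]
  simp only [← hR, ← h2]
  simp only [Finset.mul_sum]
  rw [Finset.sum_comm]
  refine Finset.sum_congr rfl fun ε _ => ?_
  rw [Finset.sum_comm]
  exact Finset.sum_congr rfl fun γ _ => Finset.sum_congr rfl fun ν _ => by ring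

omit hN' in
/-- The scalar curvatures differ by the factor `lam`, since `f^* h = lam h`. -/
theorem scalarCurv_pullback {x : Pt ι} (hx : x ∈ N)
    (hR : ∀ α μ, ∑ ν, jac p f ν α x * ∑ τ, conj (jac p f τ μ x) * ricciComp p (f x) ν τ
      = ricciComp p x α μ) :
    scalarCurv p x = (lam x : ℂ) * scalarCurv p (f x) := by
  set J : Matrix ι ι ℂ := Matrix.of fun γ α => jac p f γ α x
  set Jb : Matrix ι ι ℂ := Matrix.of fun γ α => conj (jac p f γ α x)
  set Ri : Matrix ι ι ℂ := Matrix.of fun α μ => ricciComp p x α μ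
  set Ri' : Matrix ι ι ℂ := Matrix.of fun α μ => ricciComp p (f x) α μ
  have hsc : ∀ y, scalarCurv p y
      = ((leviInv p y) * (Matrix.of fun α μ => ricciComp p y α μ).transpose).trace := by
    intro y
    simp only [scalarCurv, Matrix.trace, Matrix.diag, Matrix.mul_apply, Matrix.transpose_apply,
      Matrix.of_apply]
  have hRi : Ri = J.transpose * Ri' * Jb := by
    ext α μ
    rw [Matrix.mul_assoc, Matrix.mul_apply]
    simp only [Matrix.mul_apply, Matrix.transpose_apply, Ri, Ri', J, Jb, Matrix.of_apply]
    rw [← hR]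
    refine Finset.sum_congr rfl fun ν _ => ?_
    congr 1
    exact Finset.sum_congr rfl fun τ _ => by ring
  have hlev : J.transpose * (leviMatrix p (f x) * Jb) = clam lam x • leviMatrix p x := by
    rw [← hf.jac_mul_mixed hp hN hx]
    congr 1
  have hJ : IsUnit J.det := isUnit_iff_ne_zero.2
    (left_ne_zero_of_mul (hf.det_jac_mul_det_mixed hp hN hdet hx))
  have hH : IsUnit (leviMatrix p x).transpose.det := by
    rw [Matrix.det_transpose]
    exact isUnit_iff_ne_zero.2 (hdet x hx)
  have hH' : IsUnit (leviMatrix p (f x)).transpose.det := by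
    rw [Matrix.det_transpose]
    exact isUnit_iff_ne_zero.2 (hdet' _ (hf.mapsTo hx))
  have a1 : leviInv p x * (leviMatrix p x).transpose = 1 := Matrix.nonsing_inv_mul _ hH
  have a2 : (leviMatrix p (f x)).transpose * leviInv p (f x) = 1 := Matrix.mul_nonsing_inv _ hH'
  -- `J h^{-1} J̄ᵀ = lam h^{-1} ∘ f`
  have a3 : Jb.transpose * (leviMatrix p (f x)).transpose * J
      = clam lam x • (leviMatrix p x).transpose := by
    rw [← Matrix.transpose_smul, ← hlev]
    simp [Matrix.transpose_mul]
  have a4 : J * leviInv p x * Jb.transpose = clam lam x • leviInv p (f x) := by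
    have b1 : leviInv p x * (Jb.transpose * (leviMatrix p (f x)).transpose * J)
        = clam lam x • (1 : Matrix ι ι ℂ) := by
      rw [a3, Matrix.mul_smul, a1]
    have b2 : leviInv p x * (Jb.transpose * (leviMatrix p (f x)).transpose)
        = clam lam x • J⁻¹ := by
      have := congrArg (fun A => A * J⁻¹) b1
      simp only [Matrix.mul_assoc, Matrix.mul_nonsing_inv _ hJ, Matrix.mul_one, Matrix.smul_mul,
        Matrix.one_mul] at this
      simpa [Matrix.mul_assoc] using this
    have b3 := congrArg (fun A => J * (A * leviInv p (f x))) b2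
    simp only [Matrix.mul_assoc, a2, Matrix.mul_one, Matrix.smul_mul, Matrix.mul_smul] at b3
    rw [Matrix.mul_nonsing_inv_cancel_left _ _ hJ] at b3
    rw [Matrix.mul_assoc]
    exact b3
  rw [hsc, hsc]
  change (leviInv p x * Ri.transpose).trace = clam lam x * (leviInv p (f x) * Ri'.transpose).trace
  rw [hRi]
  have b5 : (J.transpose * Ri' * Jb).transpose = Jb.transpose * Ri'.transpose * J := by
    simp [Matrix.transpose_mul, Matrix.mul_assoc]
  rw [b5, ← Matrix.mul_assoc, Matrix.trace_mul_comm, ← Matrix.mul_assoc, ← Matrix.mul_assoc, a4,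
    Matrix.smul_mul, Matrix.trace_smul, smul_eq_mul]

end IsCRDiffeo

theorem pushforward_fst (hp : ContDiff ℝ ∞ p) (f : Pt ι → Pt ι) {x : Pt ι} {V : CTan ι}
    (hV : V ∈ holTangent p x) (ν : ι) :
    (pushforward f x V).1 ν = ∑ α, jac p f ν α x * V.1 α := by
  rw [mem_holTangent_iff hp] at hV
  conv_lhs => rw [hV]
  simp only [pushforward, act_sum_vec, act_smul_vec]
  exact Finset.sum_congr rfl fun α _ => by rw [mul_comm]; rfl

/-- Ricci components that correspond under the differential of `f` give `f^* Ric = Ric`. -/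
theorem ricci_pullback (hp : ContDiff ℝ ∞ p) {x : Pt ι}
    (hR : ∀ α μ, ∑ ν, jac p f ν α x * ∑ τ, conj (jac p f τ μ x) * ricciComp p (f x) ν τ
      = ricciComp p x α μ) {Z W : CTan ι} (hZ : Z ∈ holTangent p x) (hW : W ∈ holTangent p x) :
    ricci p (f x) (pushforward f x Z) (pushforward f x (conjVec W))
      = ricci p x Z (conjVec W) := by
  rw [pushforward_conjVec]
  simp only [ricci, conjVec, pushforward_fst hp f hZ, pushforward_fst hp f hW, ← hR, map_sum,
    map_mul]
  simp only [Finset.mul_sum, Finset.sum_mul]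
  -- reorder the four summations
  calc _ = ∑ ν, ∑ τ, ∑ α, ∑ μ, ricciComp p (f x) ν τ * (jac p f ν α x * Z.1 α)
        * (conj (jac p f τ μ x) * conj (W.1 μ)) := by
        refine Finset.sum_congr rfl fun ν _ => Finset.sum_congr rfl fun τ _ => ?_
        exact Finset.sum_comm
    _ = ∑ ν, ∑ α, ∑ τ, ∑ μ, ricciComp p (f x) ν τ * (jac p f ν α x * Z.1 α)
        * (conj (jac p f τ μ x) * conj (W.1 μ)) :=
        Finset.sum_congr rfl fun ν _ => Finset.sum_comm
    _ = ∑ α, ∑ ν, ∑ τ, ∑ μ, ricciComp p (f x) ν τ * (jac p f ν α x * Z.1 α)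
        * (conj (jac p f τ μ x) * conj (W.1 μ)) := Finset.sum_comm
    _ = ∑ α, ∑ ν, ∑ μ, ∑ τ, ricciComp p (f x) ν τ * (jac p f ν α x * Z.1 α)
        * (conj (jac p f τ μ x) * conj (W.1 μ)) :=
        Finset.sum_congr rfl fun α _ => Finset.sum_congr rfl fun ν _ => Finset.sum_comm
    _ = ∑ α, ∑ μ, ∑ ν, ∑ τ, ricciComp p (f x) ν τ * (jac p f ν α x * Z.1 α)
        * (conj (jac p f τ μ x) * conj (W.1 μ)) :=
        Finset.sum_congr rfl fun α _ => Finset.sum_comm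
    _ = _ := by
        refine Finset.sum_congr rfl fun α _ => Finset.sum_congr rfl fun μ _ =>
          Finset.sum_congr rfl fun ν _ => Finset.sum_congr rfl fun τ _ => ?_
        ring

end CRMap

/-! ### Coordinate functions and the nullity of the curvature -/

section Coordinates

variable {ι : Type} [Fintype ι] [DecidableEq ι] {p : (ι → ℂ) → ℝ}

theorem contDiff_coord (α : ι) : ContDiff ℝ ∞ (fun y : Pt ι => y.1 α) :=
  ((ContinuousLinearMap.proj (R := ℝ) (φ := fun _ : ι => ℂ) α).comp
    (ContinuousLinearMap.fst ℝ (ι → ℂ) ℝ)).contDiff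

theorem differentiableAt_coord (α : ι) (x : Pt ι) :
    DifferentiableAt ℝ (fun y : Pt ι => y.1 α) x :=
  (contDiff_coord α).contDiffAt.differentiableAt (by simp)

theorem differentiableAt_conj_coord (α : ι) (x : Pt ι) :
    DifferentiableAt ℝ (fun y : Pt ι => conj (y.1 α)) x :=
  (Complex.conjCLE.contDiff.comp (contDiff_coord α)).contDiffAt.differentiableAt (by simp)

theorem act_coord (v : CTan ι) (x : Pt ι) (α : ι) : act v (fun y => y.1 α) x = v.1 α := by
  have h := act_conj_coord (conjVec v) x α
  rw [act_conj, conjVec_conjVec] at h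
  have := congrArg conj h
  simpa [conjVec] using this

theorem sum_smul_frameZ_snd (c : ι → ℂ) (x : Pt ι) :
    (∑ σ, c σ • frameZ p σ x).2.1 = 0 := by
  simp [Prod.snd_sum, Prod.fst_sum, frameZ]

/-- The vectors whose `T^{1,0}` component is annihilated by all curvature endomorphisms. -/
noncomputable def curvNull (p : (ι → ℂ) → ℝ) (x : Pt ι) : Submodule ℂ (CTan ι) where
  carrier := {v | ∀ l μ σ, ∑ α, curvMatrix p l μ x σ α * v.1 α = 0}
  zero_mem' := by simp
  add_mem' := by
    intro v w hv hw l μ σ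
    simp only [Prod.fst_add, Pi.add_apply, mul_add, Finset.sum_add_distrib]
    rw [hv l μ σ, hw l μ σ, add_zero]
  smul_mem' := by
    intro c v hv l μ σ
    have : ∑ α, curvMatrix p l μ x σ α * (c • v).1 α
        = c * ∑ α, curvMatrix p l μ x σ α * v.1 α := by
      rw [Finset.mul_sum]
      exact Finset.sum_congr rfl fun α _ => by simp; ring
    rw [this, hv l μ σ, mul_zero]

theorem curvMatrix_symm (hp : ContDiff ℝ ∞ p) (l μ α σ : ι) (x : Pt ι) :
    curvMatrix p l μ x σ α = curvMatrix p α μ x σ l := by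
  simp only [curvMatrix, Matrix.of_apply, christoffel_symm hp l α σ]

end Coordinates

/-! ### The generalized ellipsoid -/

section Ellipsoid

variable {k : ℕ} (m d : Fin (k + 1) → ℕ)

theorem contDiff_ellP : ContDiff ℝ ∞ (ellP m d) := by
  unfold ellP groupSq
  refine ContDiff.sum fun j _ => ContDiff.pow (ContDiff.sum fun a _ => ?_) _
  exact (contDiff_apply ℝ ℂ (⟨j, a⟩ : Idx d)).norm_sq ℝ

/-- `|z_j|²` as a complex-valued function on the hypersurface. -/
noncomputable def gsq (j : Fin (k + 1)) (y : Pt (Idx d)) : ℂ :=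
  ∑ a : Fin (d j), y.1 ⟨j, a⟩ * conj (y.1 ⟨j, a⟩)

theorem gsq_eq (j : Fin (k + 1)) (y : Pt (Idx d)) : gsq d j y = (groupSq d j y.1 : ℂ) := by
  simp only [gsq, groupSq, Complex.ofReal_sum, Complex.ofReal_pow, Complex.mul_conj']

theorem contDiff_gsq (j : Fin (k + 1)) : ContDiff ℝ ∞ (gsq d j) :=
  ContDiff.sum fun _ _ => (contDiff_coord _).mul
    (Complex.conjCLE.contDiff.comp (contDiff_coord _))

theorem differentiableAt_gsq (j : Fin (k + 1)) (x : Pt (Idx d)) :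
    DifferentiableAt ℝ (gsq d j) x :=
  (contDiff_gsq d j).contDiffAt.differentiableAt (by simp)

theorem act_gsq (v : CTan (Idx d)) (j : Fin (k + 1)) (x : Pt (Idx d)) :
    act v (gsq d j) x
      = ∑ a : Fin (d j), (v.1 ⟨j, a⟩ * conj (x.1 ⟨j, a⟩) + x.1 ⟨j, a⟩ * v.2.1 ⟨j, a⟩) := by
  unfold gsq
  rw [act_sum_mul _ _ (fun a => differentiableAt_coord _ x)
    (fun a => differentiableAt_conj_coord _ x)]
  simp only [act_coord, act_conj_coord]

theorem act_ellP (v : CTan (Idx d)) (x : Pt (Idx d)) :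
    act v (fun y => (ellP m d y.1 : ℂ)) x
      = ∑ j, m j * gsq d j x ^ (m j - 1) * act v (gsq d j) x := by
  have h : (fun y : Pt (Idx d) => (ellP m d y.1 : ℂ)) = fun y => ∑ j, gsq d j y ^ m j := by
    funext y
    simp only [ellP, Complex.ofReal_sum, Complex.ofReal_pow, gsq_eq]
  rw [h, act_sum (u := fun j y => gsq d j y ^ m j) _ _
    (fun j _ => (differentiableAt_gsq d j x).pow _)]
  exact Finset.sum_congr rfl fun j _ => act_pow _ _ (differentiableAt_gsq d j x)

theorem sum_single_block (j : Fin (k + 1)) (β : Idx d) (g : Idx d → ℂ) :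
    ∑ a : Fin (d j), (Pi.single β (1 : ℂ) : Idx d → ℂ) ⟨j, a⟩ * g ⟨j, a⟩
      = if j = β.1 then g β else 0 := by
  obtain ⟨i, b⟩ := β
  by_cases h : j = i
  · subst h
    simp [Pi.single_apply]
  · simp [h]

theorem pzbar_ellP (β : Idx d) (x : Pt (Idx d)) :
    pzbar (ellP m d) x β = m β.1 * gsq d β.1 x ^ (m β.1 - 1) * x.1 β := by
  rw [← zbOp_ofReal (contDiff_ellP m d), zbOp, act_ellP]
  simp only [frameZbar_eq, act_gsq, Pi.zero_apply, zero_mul, zero_add]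
  have : ∀ j, ∑ a : Fin (d j), x.1 ⟨j, a⟩ * (Pi.single β (1 : ℂ) : Idx d → ℂ) ⟨j, a⟩
      = if j = β.1 then x.1 β else 0 := by
    intro j
    rw [← sum_single_block]
    exact Finset.sum_congr rfl fun a _ => mul_comm _ _
  simp [this]

theorem zOp_gsq (α : Idx d) (j : Fin (k + 1)) (x : Pt (Idx d)) :
    act (frameZ (ellP m d) α x) (gsq d j) x = if j = α.1 then conj (x.1 α) else 0 := by
  rw [act_gsq]
  simp only [frameZ, Pi.zero_apply, mul_zero, add_zero]
  exact sum_single_block d j α fun α => conj (x.1 α)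

/-- The Levi form: block diagonal, with blocks `∂∂̄ |z_j|^{2 m_j}`. -/
theorem leviMatrix_ellP (α β : Idx d) (x : Pt (Idx d)) :
    leviMatrix (ellP m d) x α β
      = (2 * m β.1) * (((m β.1 - 1 : ℕ) : ℂ) * (gsq d β.1 x ^ (m β.1 - 1 - 1)
          * ((if β.1 = α.1 then conj (x.1 α) else 0) * x.1 β))
        + gsq d β.1 x ^ (m β.1 - 1) * if β = α then 1 else 0) := by
  rw [leviMatrix_eq_two_mul (contDiff_ellP m d), zOp]
  simp only [pzbar_ellP, mul_assoc]
  have d1 := (differentiableAt_gsq d β.1 x).fun_pow (m β.1 - 1)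
  have d2 := differentiableAt_coord β x
  have e2 : (frameZ (ellP m d) α x).1 β = if β = α then 1 else 0 := by
    simp [frameZ, Pi.single_apply]
  rw [act_const_mul _ _ (d1.fun_mul d2), act_mul _ d1 d2,
    act_pow _ _ (differentiableAt_gsq d β.1 x), zOp_gsq, act_coord, e2]
  ring

theorem act_leviMatrix_ellP (v : CTan (Idx d)) (α β : Idx d) (x : Pt (Idx d)) :
    act v (fun y => leviMatrix (ellP m d) y α β) x
      = (2 * m β.1) * (((m β.1 - 1 : ℕ) : ℂ) *
        (((m β.1 - 1 - 1 : ℕ) * gsq d β.1 x ^ (m β.1 - 1 - 1 - 1) * act v (gsq d β.1) x)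
            * ((if β.1 = α.1 then conj (x.1 α) else 0) * x.1 β)
          + gsq d β.1 x ^ (m β.1 - 1 - 1) * ((if β.1 = α.1 then v.2.1 α else 0) * x.1 β
              + (if β.1 = α.1 then conj (x.1 α) else 0) * v.1 β))
        + ((m β.1 - 1 : ℕ) * gsq d β.1 x ^ (m β.1 - 1 - 1) * act v (gsq d β.1) x)
            * if β = α then 1 else 0) := by
  simp only [leviMatrix_ellP]
  have dq := fun n : ℕ => (differentiableAt_gsq d β.1 x).fun_pow n
  have dc : DifferentiableAt ℝ (fun y : Pt (Idx d) =>
      if β.1 = α.1 then conj (y.1 α) else 0) x := by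
    split_ifs
    · exact differentiableAt_conj_coord α x
    · exact differentiableAt_const _
  have dx := differentiableAt_coord β x
  have ec : act v (fun y : Pt (Idx d) => if β.1 = α.1 then conj (y.1 α) else 0) x
      = if β.1 = α.1 then v.2.1 α else 0 := by
    split_ifs
    · exact act_conj_coord v x α
    · exact act_const v 0 x
  have d1 := dc.fun_mul dx
  have d2 := (dq (m β.1 - 1 - 1)).fun_mul d1
  have d3 := (differentiableAt_const ((m β.1 - 1 : ℕ) : ℂ)).fun_mul d2
  have d4 := (dq (m β.1 - 1)).fun_mul
    (differentiableAt_const (𝕜 := ℝ) (x := x) (if β = α then (1 : ℂ) else 0))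
  rw [act_const_mul _ _ (d3.fun_add d4), act_add _ d3 d4, act_const_mul _ _ d2,
    act_mul _ (dq (m β.1 - 1 - 1)) d1, act_mul _ dc dx,
    act_mul _ (dq (m β.1 - 1)) (differentiableAt_const _), act_const, ec,
    act_coord, act_pow _ _ (differentiableAt_gsq d β.1 x),
    act_pow _ _ (differentiableAt_gsq d β.1 x)]
  ring

/-- The field `∑_{α ∈ I_j} z^α Z_α = m_j E_j`. -/
noncomputable def eulerE (j : Fin (k + 1)) (x : Pt (Idx d)) : CTan (Idx d) :=
  ∑ a : Fin (d j), x.1 ⟨j, a⟩ • frameZ (ellP m d) ⟨j, a⟩ x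

theorem eulerE_eq (j : Fin (k + 1)) (x : Pt (Idx d)) :
    eulerE m d j x
      = ∑ α : Idx d, (if α.1 = j then x.1 α else 0) • frameZ (ellP m d) α x := by
  rw [Fintype.sum_sigma, Finset.sum_eq_single j]
  · simp [eulerE]
  · intro i _ hi
    simp [hi]
  · simp

theorem eulerE_fst (j : Fin (k + 1)) (x : Pt (Idx d)) (β : Idx d) :
    (eulerE m d j x).1 β = if β.1 = j then x.1 β else 0 := by
  rw [eulerE_eq, sum_smul_frameZ_fst]

theorem eulerE_snd (j : Fin (k + 1)) (x : Pt (Idx d)) : (eulerE m d j x).2.1 = 0 := by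
  rw [eulerE_eq, sum_smul_frameZ_snd]

theorem act_eulerE_gsq (j i : Fin (k + 1)) (x : Pt (Idx d)) :
    act (eulerE m d j x) (gsq d i) x = if i = j then gsq d i x else 0 := by
  rw [act_gsq]
  simp only [eulerE_fst, eulerE_snd, Pi.zero_apply, mul_zero, add_zero]
  split_ifs
  · rfl
  · simp

/-- The Levi form of the `j`-th block is homogeneous of degree `m_j - 1` in `z_j`. -/
theorem act_eulerE_leviMatrix (j : Fin (k + 1)) (α β : Idx d) (x : Pt (Idx d)) :
    act (eulerE m d j x) (fun y => leviMatrix (ellP m d) y α β) x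
      = (if α.1 = j then ((m j - 1 : ℕ) : ℂ) else 0) * leviMatrix (ellP m d) x α β := by
  rw [act_leviMatrix_ellP, leviMatrix_ellP, act_eulerE_gsq, eulerE_fst, eulerE_snd]
  obtain ⟨i, b⟩ := β
  obtain ⟨i', a⟩ := α
  have hpow : ∀ n : ℕ, (n : ℂ) * gsq d i x ^ (n - 1) * gsq d i x = n * gsq d i x ^ n := by
    intro n
    cases n with
    | zero => simp
    | succ n => rw [Nat.add_sub_cancel, pow_succ]; ring
  have hcast : ∀ n : ℕ, (n : ℂ) * ((n - 1 : ℕ) + 1) = n * n := by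
    intro n
    cases n with
    | zero => simp
    | succ n => simp
  by_cases hij : i = i'
  · subst hij
    by_cases hj : i = j
    · subst hj
      simp only [if_true, Pi.zero_apply, ite_self, zero_mul, zero_add]
      rw [hpow, hpow]
      have h1 := hcast (m i - 1)
      linear_combination (2 * (m i : ℂ) * gsq d i x ^ (m i - 1 - 1)
        * conj (x.1 ⟨i, a⟩) * x.1 ⟨i, b⟩) * h1
    · simp [hj]
  · have hne : (⟨i, b⟩ : Idx d) ≠ ⟨i', a⟩ := fun h => hij (congrArg Sigma.fst h)
    simp [hij, hne]

/-- The variables of the last group do not enter the Levi form, as the exponent is `1`. -/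
theorem zOp_last_leviMatrix (hlast : m (Fin.last k) = 1) (l : Idx d) (hl : l.1 = Fin.last k)
    (α β : Idx d) (x : Pt (Idx d)) :
    zOp (ellP m d) l (fun y => leviMatrix (ellP m d) y α β) x = 0 := by
  rw [zOp, act_leviMatrix_ellP, zOp_gsq]
  by_cases h : β.1 = Fin.last k
  · simp [h, hlast]
  · have hne : β ≠ l := fun e => h (e ▸ hl)
    simp [hl, h, frameZ, hne]

/-! ### Nondegeneracy of the Levi form -/

theorem groupSq_nonneg (j : Fin (k + 1)) (z : Idx d → ℂ) : 0 ≤ groupSq d j z :=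
  Finset.sum_nonneg fun _ _ => by positivity

variable (hm : ∀ j, j ≠ Fin.last k → 1 < m j) (hlast : m (Fin.last k) = 1)
include hm hlast

/-- The Levi form is positive definite on `M`; in particular it has no isotropic vectors. -/
theorem levi_ellP_ne_zero {x : Pt (Idx d)} (hx : x ∈ ellM d) {v : Idx d → ℂ} (hv : v ≠ 0) :
    ∑ β, (∑ α, leviMatrix (ellP m d) x α β * v α) * conj (v β) ≠ 0 := by
  set s : Fin (k + 1) → ℂ := fun j => ∑ a : Fin (d j), conj (x.1 ⟨j, a⟩) * v ⟨j, a⟩ with hs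
  set r : Fin (k + 1) → ℝ := fun j => (2 * m j) * (((m j - 1 : ℕ) : ℝ)
    * (groupSq d j x.1 ^ (m j - 1 - 1) * ‖s j‖ ^ 2)
    + groupSq d j x.1 ^ (m j - 1) * groupSq d j v) with hr
  have key : ∑ β, (∑ α, leviMatrix (ellP m d) x α β * v α) * conj (v β)
      = ((∑ j, r j : ℝ) : ℂ) := by
    have h1 : ∀ β : Idx d, ∑ α, leviMatrix (ellP m d) x α β * v α
        = (2 * m β.1) * (((m β.1 - 1 : ℕ) : ℂ) * (gsq d β.1 x ^ (m β.1 - 1 - 1)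
          * (s β.1 * x.1 β)) + gsq d β.1 x ^ (m β.1 - 1) * v β) := by
      intro β
      have h2 : ∑ α : Idx d, (if β.1 = α.1 then conj (x.1 α) else 0) * v α = s β.1 := by
        rw [Fintype.sum_sigma, Finset.sum_eq_single β.1]
        · simp [hs]
        · intro i _ hi
          simp [Ne.symm hi]
        · simp
      have h3 : ∑ α : Idx d, (if β = α then (1 : ℂ) else 0) * v α = v β := by simp
      rw [← h2]
      conv_rhs => rw [← h3]
      simp only [leviMatrix_ellP, Finset.mul_sum, Finset.sum_mul, ← Finset.sum_add_distrib]
      exact Finset.sum_congr rfl fun α _ => by ring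
    rw [Fintype.sum_sigma, Complex.ofReal_sum]
    refine Finset.sum_congr rfl fun j _ => ?_
    have h4 : ∑ a : Fin (d j), x.1 ⟨j, a⟩ * conj (v ⟨j, a⟩) = conj (s j) := by
      simp [hs]
    have h5 : ∑ a : Fin (d j), v ⟨j, a⟩ * conj (v ⟨j, a⟩) = (groupSq d j v : ℂ) := by
      simp only [groupSq, Complex.ofReal_sum, Complex.ofReal_pow, Complex.mul_conj']
    have h6 : s j * conj (s j) = (‖s j‖ : ℂ) ^ 2 := Complex.mul_conj' _
    simp only [hr, h1, gsq_eq]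
    push_cast
    rw [← h5, ← h6, ← h4]
    simp only [Finset.mul_sum, ← Finset.sum_add_distrib]
    exact Finset.sum_congr rfl fun a _ => by ring
  rw [key]
  refine Complex.ofReal_ne_zero.2 (ne_of_gt ?_)
  have hr0 : ∀ j, 0 ≤ r j := by
    intro j
    have := groupSq_nonneg d j x.1
    have := groupSq_nonneg d j v
    simp only [hr]
    positivity
  obtain ⟨⟨j, a⟩, hja⟩ := Function.ne_iff.1 hv
  refine Finset.sum_pos' (fun j _ => hr0 j) ⟨j, Finset.mem_univ _, ?_⟩
  have hv0 : 0 < groupSq d j v :=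
    Finset.sum_pos' (fun _ _ => by positivity) ⟨a, Finset.mem_univ _, by
      have : v ⟨j, a⟩ ≠ 0 := hja
      positivity⟩
  have hx0 : 0 < groupSq d j x.1 ^ (m j - 1) := by
    by_cases hj : j = Fin.last k
    · rw [hj, hlast]
      simp
    · exact pow_pos (lt_of_le_of_ne (groupSq_nonneg d j x.1) (Ne.symm (hx j hj))) _
  have hm0 : (0 : ℝ) < m j := by
    by_cases hj : j = Fin.last k
    · simp [hj, hlast]
    · have := hm j hj
      exact_mod_cast (by omega : 0 < m j)
  have h1 := groupSq_nonneg d j x.1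
  have h2 : 0 ≤ ((m j - 1 : ℕ) : ℝ) * (groupSq d j x.1 ^ (m j - 1 - 1) * ‖s j‖ ^ 2) := by
    positivity
  have h3 := mul_pos hx0 hv0
  simp only [hr]
  positivity

theorem det_leviMatrix_ellP_ne_zero {x : Pt (Idx d)} (hx : x ∈ ellM d) :
    (leviMatrix (ellP m d) x).det ≠ 0 := by
  intro h
  obtain ⟨v, hv, hv0⟩ := Matrix.exists_vecMul_eq_zero_iff.2 h
  refine levi_ellP_ne_zero m d hm hlast hx hv (Finset.sum_eq_zero fun β _ => ?_)
  have : ∑ α, leviMatrix (ellP m d) x α β * v α = 0 := by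
    refine Eq.trans ?_ (congrFun hv0 β)
    exact Finset.sum_congr rfl fun α _ => mul_comm _ _
  rw [this, zero_mul]

/-! ### The nullity of the curvature of the ellipsoid -/

/-- By homogeneity, `∑_{α ∈ I_j} z^α Γ_α` is a constant matrix. -/
theorem sum_christoffel_ellP {x : Pt (Idx d)} (hx : x ∈ ellM d) (j : Fin (k + 1))
    (σ α : Idx d) :
    ∑ a : Fin (d j), x.1 ⟨j, a⟩ * christoffel (ellP m d) ⟨j, a⟩ x σ α
      = (if α.1 = j then ((m j - 1 : ℕ) : ℂ) else 0) * if σ = α then 1 else 0 := by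
  have hdet := det_leviMatrix_ellP_ne_zero m d hm hlast hx
  rw [← sum_leviInv_mul hdet σ α, Finset.mul_sum]
  simp only [christoffel, Matrix.of_apply, Finset.mul_sum]
  rw [Finset.sum_comm]
  refine Finset.sum_congr rfl fun β _ => ?_
  have h := act_eulerE_leviMatrix m d j α β x
  rw [eulerE, act_sum_vec] at h
  simp only [act_smul_vec] at h
  rw [mul_left_comm, ← h, Finset.mul_sum]
  exact Finset.sum_congr rfl fun a _ => by rw [zOp]; ring

theorem eulerE_mem_curvNull {N : Set (Pt (Idx d))} (hN : IsOpen N) (hNM : N ⊆ ellM d)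
    {x : Pt (Idx d)} (hx : x ∈ N) (j : Fin (k + 1)) :
    eulerE m d j x ∈ curvNull (ellP m d) x := by
  intro l μ σ
  have hp := contDiff_ellP m d
  have hdet := fun y hy => det_leviMatrix_ellP_ne_zero m d hm hlast (hNM hy) (x := y)
  have h1 := act_congr (frameZbar (ellP m d) μ x) hN hx
    fun y hy => sum_christoffel_ellP m d hm hlast (hNM hy) j σ l
  rw [act_const, act_sum_mul _ _ (fun a => differentiableAt_coord _ x) (fun a =>
    differentiableAt_of_contDiffOn hN (contDiffOn_christoffel hp hN hdet ⟨j, a⟩ σ l) hx)] at h1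
  rw [Fintype.sum_sigma, Finset.sum_eq_single j]
  · rw [← neg_eq_zero, ← h1, ← Finset.sum_neg_distrib]
    refine Finset.sum_congr rfl fun a _ => ?_
    rw [eulerE_fst, if_pos rfl, act_coord, curvMatrix_symm hp]
    simp only [frameZbar_eq, Pi.zero_apply, curvMatrix, Matrix.of_apply, zbOp]
    ring
  · intro i _ hi
    refine Finset.sum_eq_zero fun a _ => ?_
    rw [eulerE_fst, if_neg hi, mul_zero]
  · simp

omit hm in
theorem frameZ_last_mem_curvNull (a : Fin (d (Fin.last k))) (x : Pt (Idx d)) :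
    frameZ (ellP m d) ⟨Fin.last k, a⟩ x ∈ curvNull (ellP m d) x := by
  intro l μ σ
  have h : ∀ y, christoffel (ellP m d) ⟨Fin.last k, a⟩ y σ l = 0 := by
    intro y
    simp [christoffel, zOp_last_leviMatrix m d hlast ⟨Fin.last k, a⟩ rfl]
  have h2 : curvMatrix (ellP m d) l μ x σ ⟨Fin.last k, a⟩ = 0 := by
    rw [curvMatrix_symm (contDiff_ellP m d)]
    simp [curvMatrix, h, zbOp, act_const]
  rw [Finset.sum_eq_single ⟨Fin.last k, a⟩]
  · rw [h2, zero_mul]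
  · intro β _ hβ
    simp [frameZ, hβ]
  · simp

omit hm hlast in
theorem radialE_eq (j : Fin (k + 1)) (x : Pt (Idx d)) :
    radialE m d j x = ((1 : ℂ) / (m j : ℂ)) • eulerE m d j x := rfl

theorem bundleEW_le_curvNull {N : Set (Pt (Idx d))} (hN : IsOpen N) (hNM : N ⊆ ellM d)
    {x : Pt (Idx d)} (hx : x ∈ N) : bundleEW m d x ≤ curvNull (ellP m d) x := by
  have hE : ∀ j, radialE m d j x ∈ curvNull (ellP m d) x := fun j =>
    Submodule.smul_mem _ _ (eulerE_mem_curvNull m d hm hlast hN hNM hx j)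
  refine sup_le (Submodule.span_le.2 ?_) (Submodule.span_le.2 ?_)
  · rintro _ ⟨j, rfl⟩
    exact hE j
  · rintro _ ⟨a, rfl⟩
    exact Submodule.sub_mem _ (frameZ_last_mem_curvNull m d hlast a x)
      (Submodule.sum_mem _ fun j _ => Submodule.smul_mem _ _ (hE j))

/-- `ℰ ⊕ 𝒲_s` is nonzero wherever there are variables at all. -/
theorem exists_mem_bundleEW [Nonempty (Idx d)] {x : Pt (Idx d)} (hx : x ∈ ellM d) :
    ∃ X ∈ bundleEW m d x, X ∈ holTangent (ellP m d) x ∧ X.1 ≠ 0 := by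
  have hp := contDiff_ellP m d
  obtain ⟨j, a⟩ := (inferInstance : Nonempty (Idx d))
  by_cases hj : j = Fin.last k
  · subst hj
    refine ⟨frameZ (ellP m d) ⟨Fin.last k, a⟩ x, ?_, frameZ_mem_holTangent hp _ x, ?_⟩
    · -- `Z_α = Q(Z_α)` up to a combination of the `E_j`
      have h := Submodule.add_mem (bundleEW m d x)
        (Submodule.mem_sup_right (Submodule.subset_span ⟨a, rfl⟩))
        (Submodule.mem_sup_left (Submodule.sum_mem (bundleE m d x) (t := Finset.univ)
          fun j _ => Submodule.smul_mem _
          (levi (ellP m d) x (frameZ (ellP m d) ⟨Fin.last k, a⟩ x) (conjVec (radialE m d j x)) /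
            levi (ellP m d) x (radialE m d j x) (conjVec (radialE m d j x)))
          (Submodule.subset_span ⟨j, rfl⟩)))
      simpa [projQ] using h
    · intro h
      have := congrFun h ⟨Fin.last k, a⟩
      simp [frameZ] at this
  · refine ⟨radialE m d j x, Submodule.mem_sup_left (Submodule.subset_span ⟨j, rfl⟩), ?_, ?_⟩
    · exact Submodule.smul_mem _ _ (Submodule.sum_mem _ fun a _ =>
        Submodule.smul_mem _ _ (frameZ_mem_holTangent hp _ x))
    · intro h
      refine hx j hj (Finset.sum_eq_zero fun b _ => ?_)
      have h1 := congrFun h ⟨j, b⟩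
      rw [radialE_eq, Prod.smul_fst, Pi.smul_apply, eulerE_fst, if_pos rfl, Pi.zero_apply,
        smul_eq_zero] at h1
      have hm0 : (m j : ℂ) ≠ 0 := Nat.cast_ne_zero.2 (by have := hm j hj; omega)
      rw [h1.resolve_left (one_div_ne_zero hm0)]
      simp

end Ellipsoid

end RigidCR

theorem proposition3p6 {k : ℕ} (m d : Fin (k + 1) → ℕ)
    (hm : ∀ j, j ≠ Fin.last k → 1 < m j) (hd : ∀ j, j ≠ Fin.last k → 2 ≤ d j)
    (hlast : m (Fin.last k) = 1)
    (N N' : Set (RigidCR.Pt (RigidCR.Idx d))) (hN : IsOpen N) (hN' : IsOpen N')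
    (hNM : N ⊆ RigidCR.ellM d) (hNM' : N' ⊆ RigidCR.ellM d)
    (f : RigidCR.Pt (RigidCR.Idx d) → RigidCR.Pt (RigidCR.Idx d))
    (lam : RigidCR.Pt (RigidCR.Idx d) → ℝ)
    (hf : RigidCR.IsCRDiffeo (RigidCR.ellP m d) f N N' lam)
    (hEW : ∀ x ∈ N, RigidCR.pushforward f x '' (RigidCR.bundleEW m d x : Set _)
      = RigidCR.bundleEW m d (f x)) :
    (∀ x ∈ N, ∀ Z ∈ RigidCR.holTangent (RigidCR.ellP m d) x,
      ∀ W ∈ RigidCR.holTangent (RigidCR.ellP m d) x,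
        RigidCR.ricci (RigidCR.ellP m d) (f x)
            (RigidCR.pushforward f x Z) (RigidCR.pushforward f x (RigidCR.conjVec W))
          = RigidCR.ricci (RigidCR.ellP m d) x Z (RigidCR.conjVec W)) ∧
    (∀ x ∈ N, RigidCR.scalarCurv (RigidCR.ellP m d) x
      = (lam x : ℂ) * RigidCR.scalarCurv (RigidCR.ellP m d) (f x)) := by
  have hp := RigidCR.contDiff_ellP m d
  have hdet := fun x hx => RigidCR.det_leviMatrix_ellP_ne_zero m d hm hlast (hNM hx) (x := x)
  have hdet' := fun x hx => RigidCR.det_leviMatrix_ellP_ne_zero m d hm hlast (hNM' hx) (x := x)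
  have key : ∀ x ∈ N, ∀ α μ, ∑ ν, RigidCR.jac (RigidCR.ellP m d) f ν α x
      * ∑ τ, (starRingEnd ℂ) (RigidCR.jac (RigidCR.ellP m d) f τ μ x)
        * RigidCR.ricciComp (RigidCR.ellP m d) (f x) ν τ
      = RigidCR.ricciComp (RigidCR.ellP m d) x α μ := by
    intro x hx α μ
    have : Nonempty (RigidCR.Idx d) := ⟨α⟩
    obtain ⟨X, hX, hXh, hX0⟩ := RigidCR.exists_mem_bundleEW m d hm hlast (hNM hx)
    refine hf.ricciComp_pullback hp hN hdet hdet' hx ?_ α μ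
    refine hf.curvMatrix_pullback hp hN hN' hdet hdet' hx
      (RigidCR.levi_ellP_ne_zero m d hm hlast (hNM hx) hX0)
      (RigidCR.bundleEW_le_curvNull m d hm hlast hN hNM hx hX) ?_
    have hfX : RigidCR.pushforward f x X ∈ RigidCR.bundleEW m d (f x) := by
      rw [← SetLike.mem_coe, ← hEW x hx]
      exact ⟨X, hX, rfl⟩
    intro l μ σ
    have h := RigidCR.bundleEW_le_curvNull m d hm hlast hN' hNM' (hf.mapsTo hx) hfX l μ σ
    simpa only [RigidCR.pushforward_fst hp f hXh] using h
  exact ⟨fun x hx Z hZ W hW => RigidCR.ricci_pullback hp (key x hx) hZ hW,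
    fun x hx => hf.scalarCurv_pullback hp hN hdet hdet' hx (key x hx)⟩
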